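/- For an integer $k\ge 1$ let $d_k(n)$ be the number of ordered $k$-tuples of positive integers with product $n$, and for $x>0$ put $$\Delta_k(x)=\sum_{n\le x}d_k(n)-\operatorname*{Res}_{s=1}\frac{x^s\zeta^k(s)}{s},$$ where $\zeta$ is the Riemann zeta-function. Let $k\ge 3$ be a fixed integer and let $\sigma(k)$ be a fixed real number with $\frac12\le\sigma(k)<1$ such that, for every $\varepsilon>0$, $$\int_0^T|\zeta(\sigma(k)+it)|^{2k}\,dt\ll_\varepsilon T^{1+\varepsilon}\qquad(T\to\infty).$$ (i) If $\sigma(k)=\frac12$, then for every $\varepsilon>0$ one has $$\int_X^{2X}\bigl(\Delta_k(x+h)-\Delta_k(x)\bigr)^2\,dx\ll_\varepsilon X^{1+\varepsilon}h^{4/3}$$ uniformly for all real $X\ge1$ and $X^\varepsilon\le h\le X^{1-\varepsilon}$, where the implied constant depends only on $k$ and $\varepsilon$. (ii) If $\frac12<\sigma(k)<1$ and $\theta(k)$ is any constant with $2\sigma(k)-1<\theta(k)<1$, then there is an $\varepsilon_1>0$, depending only on $k$, $\sigma(k)$ and $\theta(k)$, such that for every $\varepsilon>0$ one has $$\int_X^{2X}\bigl(\Delta_k(x+h)-\Delta_k(x)\bigr)^2\,dx\ll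 X^{1-\varepsilon_1}h^{2}$$ uniformly for all real $X\ge1$ and $X^{\theta(k)}\le h\le X^{1-\varepsilon}$, where the implied constant depends only on $k$, $\sigma(k)$, $\theta(k)$ and $\varepsilon_1$ (and not on $\varepsilon$). -/

import Mathlib

noncomputable section

open Filter Asymptotics

/-- The generalized divisor function `d_k(n)`: the number of ordered `k`-tuples of positive
integers with product `n` (and `0` for `n = 0`). -/
def divisorFn (k n : ℕ) : ℕ := (Nat.finMulAntidiag k n).card

/-- The residue at `a` of a function with an isolated singularity at `a`: the value of
`(2πi)⁻¹ ∮ f` over small circles `|z - a| = r`, which does not depend on `r` once `r` is small. -/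
def residue (f : ℂ → ℂ) (a : ℂ) : ℂ :=
  limUnder (nhdsWithin (0 : ℝ) (Set.Ioi 0))
    (fun r : ℝ => (2 * (Real.pi : ℂ) * Complex.I)⁻¹ * circleIntegral f a r)

/-- The main term `Res_{s=1} x^s ζ(s)^k / s = x P_{k-1}(log x)`, a real number for `x > 0`. -/
def divisorMainTerm (k : ℕ) (x : ℝ) : ℝ :=
  (residue (fun s : ℂ => (x : ℂ) ^ s * riemannZeta s ^ k / s) 1).re

/-- The error term `Δ_k(x) = ∑_{n ≤ x} d_k(n) - Res_{s=1} x^s ζ(s)^k / s`. -/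
def divisorError (k : ℕ) (x : ℝ) : ℝ :=
  (∑ n ∈ Finset.Icc 1 ⌊x⌋₊, (divisorFn k n : ℝ)) - divisorMainTerm k x

/-- The mean square `∫_X^{2X} (Δ_k(x+h) - Δ_k(x))² dx`. -/
def shortMeanSquare (k : ℕ) (X h : ℝ) : ℝ :=
  ∫ x in X..(2 * X), (divisorError k (x + h) - divisorError k x) ^ 2

/-- `σ` is an admissible value of `σ(k)`: `1/2 ≤ σ < 1` and, for every `ε > 0`,
`∫_0^T |ζ(σ+it)|^{2k} dt ≪_ε T^{1+ε}`. -/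
def IsAdmissibleSigma (k : ℕ) (σ : ℝ) : Prop :=
  1 / 2 ≤ σ ∧ σ < 1 ∧ ∀ ε : ℝ, 0 < ε →
    (fun T : ℝ => ∫ t in (0 : ℝ)..T,
        ‖riemannZeta ((σ : ℂ) + (t : ℂ) * Complex.I)‖ ^ (2 * k))
      =O[atTop] fun T : ℝ => T ^ (1 + ε)

end

open Asymptotics Complex Filter MeasureTheory ProbabilityTheory Set Topology
open scoped ContDiff FourierTransform NNReal

/-!
Let `R(w)` be the remainder in the divisor problem at `x = exp w`, so that `Δ_k(exp w)` is the real
part of `R(w)`. The Laplace transform of `R` in a far right half-plane is the function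
`ζ(s) ^ k / s` with its principal part at `s = 1` removed, which is holomorphic for `0 < re s`.
After multiplication by a Gaussian factor one may shift the line of integration to `re s = σ`;
Plancherel's theorem, and Fatou's lemma on removing the factor, bound the weighted mean square of
`R(w + b) - R(w)` by the integral of `|ζ(s) ^ k / s| ^ 2 * |exp (b s) - 1| ^ 2` over that line (up
to the principal part). The moment hypothesis makes this `O(b ^ (1 - η))`, a mean square bound for
the multiplicative shifts `x ↦ x * exp b`. Finally, averaging over an auxiliary shift
`v ∈ [2h, 3h]`, as Saffari and Vaughan do, transfers the bound to the additive shifts `x ↦ x + h`.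
-/

/-! ### The generalized divisor function -/

theorem divisorFn_zero (n : ℕ) : divisorFn 0 n = (1 : ArithmeticFunction ℕ) n := by
  rcases eq_or_ne n 1 with rfl | hn
  · simp [divisorFn, Nat.finMulAntidiag_one]
  · simp [divisorFn, Nat.finMulAntidiag_zero_left hn, hn]

theorem divisorFn_succ (k n : ℕ) :
    divisorFn (k + 1) n = ∑ p ∈ n.divisorsAntidiagonal, divisorFn k p.2 := by
  simp only [divisorFn]
  rw [← Finset.card_sigma]
  refine Finset.card_bij' (fun f _ => ⟨(f 0, ∏ i, Fin.tail f i), Fin.tail f⟩)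
    (fun q _ => Fin.cons q.1.1 q.2) ?_ ?_ (fun f _ => Fin.cons_self_tail f) ?_
  · intro f hf
    obtain ⟨hprod, hn⟩ := by simpa only [Nat.mem_finMulAntidiag, Fin.prod_univ_succ] using hf
    have htail : ∏ i, Fin.tail f i ≠ 0 := fun h => hn (hprod ▸ mul_eq_zero_of_right _ h)
    simpa [Fin.tail, hn, hprod] using htail
  · rintro ⟨⟨a, b⟩, f⟩ hq
    simp only [Finset.mem_sigma, Nat.mem_divisorsAntidiagonal, Nat.mem_finMulAntidiag] at hq
    simpa only [Nat.mem_finMulAntidiag, Fin.prod_univ_succ, Fin.cons_zero, Fin.cons_succ, hq.2.1]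
      using hq.1
  · rintro ⟨⟨a, b⟩, f⟩ hq
    simp only [Finset.mem_sigma, Nat.mem_finMulAntidiag] at hq
    simp only [Fin.cons_zero, Fin.tail_cons, hq.2.1]

theorem divisorFn_eq_zeta_pow (k n : ℕ) :
    divisorFn k n = (ArithmeticFunction.zeta ^ k) n := by
  induction k generalizing n with
  | zero => rw [divisorFn_zero, pow_zero]
  | succ k ih =>
    rw [divisorFn_succ, pow_succ', ArithmeticFunction.mul_apply]
    refine Finset.sum_congr rfl fun p hp => ?_
    rw [ih, ArithmeticFunction.zeta_apply_ne (Nat.ne_zero_of_mem_divisorsAntidiagonal hp).1,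
      one_mul]

theorem divisorFn_le_pow (k n : ℕ) : divisorFn k n ≤ n ^ k := by
  rcases eq_or_ne n 0 with rfl | hn
  · simp [divisorFn]
  calc divisorFn k n ≤ (Fintype.piFinset fun _ : Fin k => n.divisors).card := by
        rw [divisorFn, Nat.finMulAntidiag_eq_piFinset_divisors_filter dvd_rfl hn]
        exact Finset.card_filter_le _ _
    _ = n.divisors.card ^ k := Fintype.card_piFinset_const _ _
    _ ≤ n ^ k := Nat.pow_le_pow_left (Nat.card_divisors_le_self n) k

theorem sum_divisorFn_le_pow (k N : ℕ) : ∑ n ∈ Finset.Icc 1 N, divisorFn k n ≤ N ^ (k + 1) :=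
  calc ∑ n ∈ Finset.Icc 1 N, divisorFn k n ≤ ∑ _n ∈ Finset.Icc 1 N, N ^ k :=
        Finset.sum_le_sum fun n hn =>
          (divisorFn_le_pow k n).trans (Nat.pow_le_pow_left (Finset.mem_Icc.1 hn).2 k)
    _ = N ^ (k + 1) := by simp [pow_succ']

theorem natCoe_pow (f : ArithmeticFunction ℕ) (k : ℕ) :
    ((f ^ k : ArithmeticFunction ℕ) : ArithmeticFunction ℂ) = (f : ArithmeticFunction ℂ) ^ k := by
  induction k with
  | zero => simp only [pow_zero, ArithmeticFunction.natCoe_one]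
  | succ k ih => rw [pow_succ, pow_succ, ArithmeticFunction.natCoe_mul, ih]

theorem LSeriesHasSum_pow {f : ArithmeticFunction ℂ} {s a : ℂ} (hf : LSeriesHasSum (f ·) s a)
    (k : ℕ) : LSeriesHasSum ((f ^ k) ·) s (a ^ k) := by
  induction k with
  | zero =>
    rw [pow_zero, pow_zero, ArithmeticFunction.one_eq_delta, LSeriesHasSum,
      funext (LSeries.term_delta s)]
    exact hasSum_ite_eq 1 1
  | succ k ih =>
    rw [pow_succ, pow_succ]
    exact ArithmeticFunction.LSeriesHasSum_mul ih hf

theorem LSeriesHasSum_divisorFn (k : ℕ) {s : ℂ} (hs : 1 < s.re) :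
    LSeriesHasSum (fun n => (divisorFn k n : ℂ)) s (riemannZeta s ^ k) := by
  have hζ : LSeriesHasSum ((ArithmeticFunction.zeta : ArithmeticFunction ℂ) ·) s
      (riemannZeta s) := by
    simpa using ArithmeticFunction.LSeriesHasSum_zeta hs
  simpa only [divisorFn_eq_zeta_pow, ← natCoe_pow, ArithmeticFunction.natCoe_apply]
    using LSeriesHasSum_pow hζ k

/-! ### Growth of the zeta function in the half-plane `0 < Re s` -/

/-- The integral `∫_1^∞ {t} t^{-s-1} dt` of the fractional part, which continues the zeta function
to the half-plane `0 < Re s` through `ζ(s) = s / (s - 1) - s ∫_1^∞ {t} t^{-s-1} dt`. -/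
noncomputable def fractIntegral (s : ℂ) : ℂ :=
  ∫ t : ℝ in Ioi 1, ((Int.fract t : ℝ) : ℂ) * (t : ℂ) ^ (-(s + 1))

theorem norm_ofReal_fract_le_one (t : ℝ) : ‖((Int.fract t : ℝ) : ℂ)‖ ≤ 1 := by
  rw [norm_real, Real.norm_of_nonneg (Int.fract_nonneg t)]
  exact (Int.fract_lt_one t).le

theorem integrableOn_Ioi_fract_mul_cpow {s : ℂ} (hs : 0 < s.re) :
    IntegrableOn (fun t : ℝ => ((Int.fract t : ℝ) : ℂ) * (t : ℂ) ^ (-(s + 1))) (Ioi 1) := by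
  have hcpow : IntegrableOn (fun t : ℝ => (t : ℂ) ^ (-(s + 1))) (Ioi 1) :=
    integrableOn_Ioi_cpow_of_lt (by simpa using hs) one_pos
  exact hcpow.bdd_mul (c := 1) (by fun_prop) (Eventually.of_forall norm_ofReal_fract_le_one)

theorem norm_fractIntegral_le {s : ℂ} (hs : 0 < s.re) : ‖fractIntegral s‖ ≤ 1 / s.re := by
  have hlt : -(s.re + 1) < -1 := by linarith
  calc ‖fractIntegral s‖ ≤ ∫ t : ℝ in Ioi 1, t ^ (-(s.re + 1)) := by
        refine norm_integral_le_of_norm_le (integrableOn_Ioi_rpow_of_lt hlt one_pos) ?_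
        filter_upwards [ae_restrict_mem measurableSet_Ioi] with t ht
        have ht0 : 0 < t := one_pos.trans ht
        rw [norm_mul, norm_cpow_eq_rpow_re_of_pos ht0]
        simpa using mul_le_of_le_one_left (Real.rpow_nonneg ht0.le (-(s.re + 1)))
          (norm_ofReal_fract_le_one t)
    _ = 1 / s.re := by
        rw [integral_Ioi_rpow_of_lt hlt one_pos, Real.one_rpow,
          show -(s.re + 1) + 1 = -s.re by ring, neg_div_neg_eq]

theorem fractIntegral_eq_mellin (s : ℂ) :
    fractIntegral s = mellin ((Ioi 1).indicator fun t => ((Int.fract t : ℝ) : ℂ)) (-s) := by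
  have hsub : Ioi (1 : ℝ) ∩ Ioi 0 = Ioi 1 := inter_eq_left.2 (Ioi_subset_Ioi zero_le_one)
  simp_rw [mellin, ← indicator_smul (Ioi (1 : ℝ)), integral_indicator measurableSet_Ioi,
    Measure.restrict_restrict measurableSet_Ioi, hsub, fractIntegral, smul_eq_mul, neg_add',
    mul_comm]

theorem differentiableOn_fractIntegral : DifferentiableOn ℂ fractIntegral {s | 0 < s.re} := by
  set f : ℝ → ℂ := (Ioi 1).indicator fun t => ((Int.fract t : ℝ) : ℂ)
  have hbound : ∀ t, ‖f t‖ ≤ 1 := fun t =>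
    (norm_indicator_le_norm_self _ t).trans (norm_ofReal_fract_le_one t)
  have hmeas : Measurable f := Measurable.indicator (by fun_prop) measurableSet_Ioi
  have hloc : LocallyIntegrableOn f (Ioi 0) :=
    ((locallyIntegrable_const (1 : ℝ)).mono hmeas.aestronglyMeasurable
      (Eventually.of_forall fun t => by simpa using hbound t)).locallyIntegrableOn _
  have htop : f =O[atTop] fun t : ℝ => t ^ (-0 : ℝ) :=
    IsBigO.of_bound 1 (Eventually.of_forall fun t => by simpa using hbound t)
  have hzero : f =ᶠ[𝓝[>] 0] 0 := by
    filter_upwards [Ioo_mem_nhdsGT one_pos] with t ht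
    exact indicator_of_notMem (fun h => lt_asymm h ht.2) _
  intro s hs
  have hs' : 0 < s.re := hs
  rw [funext fractIntegral_eq_mellin]
  exact (mellin_differentiableAt_of_isBigO_rpow hloc htop (by simpa using hs')
    (hzero.trans_isBigO (isBigO_zero (fun t : ℝ => t ^ (-(-s.re - 1))) _))
    (by simp)).comp s differentiableAt_id.neg |>.differentiableWithinAt

theorem riemannZeta_eq_mul_integral_floor {s : ℂ} (hs : 1 < s.re) :
    riemannZeta s = s * ∫ t : ℝ in Ioi 1, (⌊t⌋₊ : ℂ) * (t : ℂ) ^ (-(s + 1)) := by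
  rw [← LSeries_one_eq_riemannZeta hs, LSeries_eq_mul_integral 1 zero_le_one hs
    (LSeriesSummable_one_iff.2 hs)
    (IsBigO.of_bound 1 (Eventually.of_forall fun n => by simp))]
  simp

theorem riemannZeta_eq_div_sub_mul_fractIntegral {s : ℂ} (hs : 1 < s.re) :
    riemannZeta s = s / (s - 1) - s * fractIntegral s := by
  have hs1 : s - 1 ≠ 0 := sub_ne_zero.2 (by rintro rfl; simp at hs)
  have hexp : (-s).re < -1 := by simpa using hs
  have hfract := integrableOn_Ioi_fract_mul_cpow (one_pos.trans hs)
  have hfloor : ∀ t ∈ Ioi (1 : ℝ), (⌊t⌋₊ : ℂ) * (t : ℂ) ^ (-(s + 1)) =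
      (t : ℂ) ^ (-s) - ((Int.fract t : ℝ) : ℂ) * (t : ℂ) ^ (-(s + 1)) := by
    intro t ht
    have ht0 : 0 < t := one_pos.trans ht
    have hpow : (t : ℂ) ^ (-s) = t * (t : ℂ) ^ (-(s + 1)) := by
      rw [neg_add, cpow_add _ _ (ofReal_ne_zero.2 ht0.ne'), cpow_neg_one,
        mul_left_comm, mul_inv_cancel₀ (ofReal_ne_zero.2 ht0.ne'), mul_one]
    rw [hpow, Int.fract, ofReal_sub, ofReal_intCast, ← Int.natCast_floor_eq_floor ht0.le,
      Int.cast_natCast]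
    ring
  rw [riemannZeta_eq_mul_integral_floor hs, setIntegral_congr_fun measurableSet_Ioi hfloor,
    integral_sub (integrableOn_Ioi_cpow_of_lt hexp one_pos) hfract,
    integral_Ioi_cpow_of_lt hexp one_pos, ofReal_one, one_cpow, fractIntegral]
  have : -s + 1 ≠ 0 := fun h => hs1 (by linear_combination -h)
  field_simp
  ring

theorem isOpen_re_pos : IsOpen {s : ℂ | 0 < s.re} := isOpen_lt continuous_const continuous_re

theorem riemannZeta₁_eq_sub_fractIntegral {s : ℂ} (hs : 0 < s.re) :
    riemannZeta₁ s = s - s * (s - 1) * fractIntegral s := by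
  have hleft : AnalyticOnNhd ℂ riemannZeta₁ {z | 0 < z.re} :=
    differentiable_riemannZeta₁.differentiableOn.analyticOnNhd isOpen_re_pos
  have hright : AnalyticOnNhd ℂ (fun z => z - z * (z - 1) * fractIntegral z) {z | 0 < z.re} :=
    DifferentiableOn.analyticOnNhd (differentiableOn_id.sub
      ((differentiableOn_id.mul (differentiableOn_id.sub_const 1)).mul
        differentiableOn_fractIntegral)) isOpen_re_pos
  refine hleft.eqOn_of_preconnected_of_eventuallyEq hright
    (convex_halfSpace_re_gt 0).isPreconnected (z₀ := 2) (by simp) ?_ hs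
  filter_upwards [(isOpen_lt continuous_const continuous_re).mem_nhds
    (show (1 : ℝ) < (2 : ℂ).re by simp)] with z hz
  have hz1 : z ≠ 1 := by
    rintro rfl
    simp at hz
  have hz1' := sub_ne_zero.2 hz1
  have hzeta := riemannZeta_eq_div_sub_mul_fractIntegral hz
  rw [riemannZeta_eq_inv_sub_mul hz1] at hzeta
  field_simp at hzeta
  rw [hzeta]
  ring

theorem norm_riemannZeta₁_le {s : ℂ} (hs : 0 < s.re) :
    ‖riemannZeta₁ s‖ ≤ ‖s‖ * (1 + ‖s - 1‖ / s.re) := by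
  calc ‖riemannZeta₁ s‖ = ‖s * (1 - (s - 1) * fractIntegral s)‖ := by
        rw [riemannZeta₁_eq_sub_fractIntegral hs]
        ring_nf
    _ ≤ ‖s‖ * (1 + ‖s - 1‖ / s.re) := by
        rw [norm_mul, div_eq_mul_one_div]
        gcongr
        refine (norm_sub_le _ _).trans ?_
        rw [norm_one, norm_mul]
        gcongr
        exact norm_fractIntegral_le hs

/-! ### Polar expansions and residues -/

/-- On `U ∖ {c}` the function `f` is the sum of the principal part `∑_{j < n} a_j (s - c)^{-(j+1)}`
and of a regular part `H`, holomorphic on the whole of `U`. The order of the pole may be less than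
`n`. -/
structure HasPoleExpansion (f : ℂ → ℂ) (c : ℂ) (U : Set ℂ) (n : ℕ) (a : ℕ → ℂ) (H : ℂ → ℂ) :
    Prop where
  differentiableOn : DifferentiableOn ℂ H U
  eq_sum_add : ∀ s ∈ U, s ≠ c → f s = ∑ j ∈ Finset.range n, a j / (s - c) ^ (j + 1) + H s

theorem exists_hasPoleExpansion_div_pow {g : ℂ → ℂ} {c : ℂ} {U : Set ℂ} (hU : U ∈ 𝓝 c)
    (hg : DifferentiableOn ℂ g U) (n : ℕ) :
    ∃ a H, HasPoleExpansion (fun s => g s / (s - c) ^ n) c U n a H := by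
  induction n generalizing g with
  | zero => exact ⟨0, g, hg, fun s _ _ => by simp⟩
  | succ n ih =>
    obtain ⟨a, H, hH, hsum⟩ := ih ((differentiableOn_dslope hU).2 hg)
    refine ⟨Function.update a n (g c), H, hH, fun s hs hsc => ?_⟩
    have hsc' : s - c ≠ 0 := sub_ne_zero.2 hsc
    have hslope : g s = g c + (s - c) * dslope g c s := by
      rw [← smul_eq_mul, sub_smul_dslope, add_sub_cancel]
    have hlow : ∀ j ∈ Finset.range n, Function.update a n (g c) j / (s - c) ^ (j + 1) =
        a j / (s - c) ^ (j + 1) := fun j hj => by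
      rw [Function.update_of_ne (Finset.mem_range.1 hj).ne]
    have hs' := hsum s hs hsc
    rw [Finset.sum_range_succ, Finset.sum_congr rfl hlow, Function.update_self,
      add_right_comm, ← hs', hslope, pow_succ']
    field_simp
    ring

theorem circleIntegral_mul_div_sub_pow {φ : ℂ → ℂ} {c : ℂ} {r : ℝ} (hr : 0 < r)
    (hφ : DifferentiableOn ℂ φ (Metric.closedBall c r)) (b : ℂ) (j : ℕ) :
    ∮ s in C(c, r), φ s * (b / (s - c) ^ (j + 1)) =
      2 * Real.pi * I * (b * iteratedDeriv j φ c / j.factorial) := by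
  have hrw : ∀ s, φ s * (b / (s - c) ^ (j + 1)) = b * ((1 / (s - c) ^ (j + 1)) • φ s) := fun s => by
    rw [smul_eq_mul]
    ring
  simp_rw [hrw]
  rw [circleIntegral.integral_const_mul,
    DifferentiableOn.circleIntegral_one_div_sub_center_pow_smul hr j hφ, smul_eq_mul]
  ring

theorem HasPoleExpansion.circleIntegral_mul {f φ H : ℂ → ℂ} {c : ℂ} {U : Set ℂ} {n : ℕ}
    {a : ℕ → ℂ} (hf : HasPoleExpansion f c U n a H) (hφ : DifferentiableOn ℂ φ U) {r : ℝ}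
    (hr : 0 < r) (hrU : Metric.closedBall c r ⊆ U) :
    ∮ s in C(c, r), φ s * f s =
      2 * Real.pi * I * ∑ j ∈ Finset.range n, a j * iteratedDeriv j φ c / j.factorial := by
  have hφr := hφ.mono hrU
  have hHr := hf.differentiableOn.mono hrU
  have hne : ∀ s ∈ Metric.sphere c r, s ≠ c := fun s hs => Metric.ne_of_mem_sphere hs hr.ne'
  have hφs := hφr.continuousOn.mono Metric.sphere_subset_closedBall
  have hterm : ∀ j ∈ Finset.range n,
      CircleIntegrable (fun s => φ s * (a j / (s - c) ^ (j + 1))) c r := fun j _ =>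
    (hφs.mul (continuousOn_const.div (by fun_prop) fun s hs =>
      pow_ne_zero _ (sub_ne_zero.2 (hne s hs)))).circleIntegrable hr.le
  have hregular : CircleIntegrable (fun s => φ s * H s) c r :=
    (hφs.mul (hHr.continuousOn.mono Metric.sphere_subset_closedBall)).circleIntegrable hr.le
  have hcauchy : ∮ s in C(c, r), φ s * H s = 0 :=
    circleIntegral_eq_zero_of_differentiable_on_off_countable hr.le countable_empty
      (hφr.mul hHr).continuousOn fun z hz =>
        (hφr.mul hHr).differentiableAt (Metric.closedBall_mem_nhds_of_mem hz.1)
  have hsplit : EqOn (fun s => φ s * f s)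
      (fun s => ∑ j ∈ Finset.range n, φ s * (a j / (s - c) ^ (j + 1)) + φ s * H s)
      (Metric.sphere c r) := fun s hs => by
    simp only [hf.eq_sum_add s (hrU (Metric.sphere_subset_closedBall hs)) (hne s hs), mul_add,
      Finset.mul_sum]
  rw [circleIntegral.integral_congr hr.le hsplit,
    circleIntegral.integral_add (CircleIntegrable.fun_sum _ hterm) hregular,
    circleIntegral.integral_fun_sum hterm, hcauchy, add_zero, Finset.mul_sum]
  exact Finset.sum_congr rfl fun j _ => circleIntegral_mul_div_sub_pow hr hφr (a j) j

theorem HasPoleExpansion.residue_mul {f φ H : ℂ → ℂ} {c : ℂ} {U : Set ℂ} {n : ℕ} {a : ℕ → ℂ}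
    (hf : HasPoleExpansion f c U n a H) (hU : U ∈ 𝓝 c) (hφ : DifferentiableOn ℂ φ U) :
    residue (fun s => φ s * f s) c =
      ∑ j ∈ Finset.range n, a j * iteratedDeriv j φ c / j.factorial := by
  obtain ⟨R, hR, hRU⟩ := Metric.nhds_basis_closedBall.mem_iff.1 hU
  refine Tendsto.limUnder_eq (tendsto_const_nhds.congr' ?_)
  filter_upwards [Ioo_mem_nhdsGT hR] with r hr
  rw [hf.circleIntegral_mul hφ hr.1 ((Metric.closedBall_subset_closedBall hr.2.le).trans hRU),
    inv_mul_cancel_left₀ two_pi_I_ne_zero]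

theorem setOf_re_pos_mem_nhds_one : {s : ℂ | 0 < s.re} ∈ 𝓝 1 :=
  isOpen_re_pos.mem_nhds (by simp)

theorem exists_hasPoleExpansion_riemannZeta_pow_div (k : ℕ) :
    ∃ a H, HasPoleExpansion (fun s => riemannZeta s ^ k / s) 1 {s | 0 < s.re} k a H := by
  have hg : DifferentiableOn ℂ (fun s => riemannZeta₁ s ^ k / s) {s : ℂ | 0 < s.re} := by
    refine (differentiable_riemannZeta₁.pow k).differentiableOn.div differentiableOn_id ?_
    rintro s hs rfl
    simp at hs
  obtain ⟨a, H, hH, hsum⟩ := exists_hasPoleExpansion_div_pow setOf_re_pos_mem_nhds_one hg k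
  refine ⟨a, H, hH, fun s hs hs1 => ?_⟩
  rw [← hsum s hs hs1, riemannZeta_eq_inv_sub_mul hs1, mul_pow, inv_pow]
  ring

/-- Coefficients `a_j` of the principal part `∑_{j < k} a_j (s - 1)^{-(j+1)}` of `ζ(s)^k / s` at
its pole `1`. -/
noncomputable def zetaPowPolarCoeff (k : ℕ) : ℕ → ℂ :=
  (exists_hasPoleExpansion_riemannZeta_pow_div k).choose

/-- What is left of `ζ(s)^k / s` in the half-plane `0 < Re s` once its principal part at `1` has
been removed. -/
noncomputable def zetaPowRegularPart (k : ℕ) : ℂ → ℂ :=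
  (exists_hasPoleExpansion_riemannZeta_pow_div k).choose_spec.choose

theorem hasPoleExpansion_zetaPow (k : ℕ) :
    HasPoleExpansion (fun s => riemannZeta s ^ k / s) 1 {s | 0 < s.re} k (zetaPowPolarCoeff k)
      (zetaPowRegularPart k) :=
  (exists_hasPoleExpansion_riemannZeta_pow_div k).choose_spec.choose_spec

theorem divisorMainTerm_exp (k : ℕ) (w : ℝ) :
    divisorMainTerm k (Real.exp w) =
      (exp w * ∑ j ∈ Finset.range k, zetaPowPolarCoeff k j * (w : ℂ) ^ j / j.factorial).re := by
  have hcpow : ∀ s : ℂ, (Real.exp w : ℂ) ^ s = exp (w * s) := fun s => by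
    rw [ofReal_exp, cpow_def_of_ne_zero (exp_ne_zero _), ← ofReal_exp,
      ← ofReal_log (Real.exp_pos w).le, Real.log_exp]
  simp_rw [divisorMainTerm, mul_div_assoc, hcpow]
  rw [(hasPoleExpansion_zetaPow k).residue_mul setOf_re_pos_mem_nhds_one
    (by fun_prop : Differentiable ℂ fun s : ℂ => exp (w * s)).differentiableOn]
  simp_rw [iteratedDeriv_cexp_const_mul, mul_one, Finset.mul_sum]
  congr 1
  exact Finset.sum_congr rfl fun j _ => by ring

/-! ### Bounds for the regular part of `ζ(s)^k / s` -/

theorem norm_sum_div_pow_le {n : ℕ} (a : ℕ → ℂ) {z : ℂ} {δ : ℝ} (hδ : 0 < δ) (hz : δ ≤ ‖z‖) :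
    ‖∑ j ∈ Finset.range n, a j / z ^ (j + 1)‖ ≤
      (∑ j ∈ Finset.range n, ‖a j‖ * δ⁻¹ ^ j) * ‖z‖⁻¹ := by
  rw [Finset.sum_mul]
  refine (norm_sum_le _ _).trans (Finset.sum_le_sum fun j _ => ?_)
  rw [norm_div, norm_pow, div_eq_mul_inv, ← inv_pow, pow_succ, ← mul_assoc]
  gcongr

theorem norm_riemannZeta_le {s : ℂ} (hs : 0 < s.re) (hs1 : 1 ≤ ‖s - 1‖) :
    ‖riemannZeta s‖ ≤ ‖s‖ * (1 + 1 / s.re) := by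
  have hpos : 0 < ‖s - 1‖ := one_pos.trans_le hs1
  rw [riemannZeta_eq_inv_sub_mul (sub_ne_zero.1 (norm_pos_iff.1 hpos)), norm_mul, norm_inv]
  calc ‖s - 1‖⁻¹ * ‖riemannZeta₁ s‖ ≤ ‖s - 1‖⁻¹ * (‖s‖ * (1 + ‖s - 1‖ / s.re)) := by
        gcongr
        exact norm_riemannZeta₁_le hs
    _ = ‖s‖ * (‖s - 1‖⁻¹ + 1 / s.re) := by field_simp
    _ ≤ ‖s‖ * (1 + 1 / s.re) := by
        gcongr
        exact inv_le_one_of_one_le₀ hs1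

theorem zetaPowRegularPart_eq_sub (k : ℕ) {s : ℂ} (hs : 0 < s.re) (hs1 : s ≠ 1) :
    zetaPowRegularPart k s = riemannZeta s ^ k / s -
      ∑ j ∈ Finset.range k, zetaPowPolarCoeff k j / (s - 1) ^ (j + 1) :=
  eq_sub_of_add_eq' ((hasPoleExpansion_zetaPow k).eq_sum_add s hs hs1).symm

theorem norm_zetaPowRegularPart_le (k : ℕ) {s : ℂ} (hs : 0 < s.re) (him : 1 ≤ |s.im|) :
    ‖zetaPowRegularPart k s‖ ≤
      (‖s‖ * (1 + 1 / s.re)) ^ k + ∑ j ∈ Finset.range k, ‖zetaPowPolarCoeff k j‖ := by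
  have hs0 : 1 ≤ ‖s‖ := him.trans (abs_im_le_norm s)
  have hs1 : 1 ≤ ‖s - 1‖ := him.trans (by simpa using abs_im_le_norm (s - 1))
  have hne : s ≠ 1 := sub_ne_zero.1 (norm_pos_iff.1 (one_pos.trans_le hs1))
  rw [zetaPowRegularPart_eq_sub k hs hne]
  refine (norm_sub_le _ _).trans (add_le_add ?_ ?_)
  · rw [norm_div, norm_pow]
    exact (div_le_self (by positivity) hs0).trans
      (pow_le_pow_left₀ (norm_nonneg _) (norm_riemannZeta_le hs hs1) k)
  · refine (norm_sum_div_pow_le _ one_pos hs1).trans ?_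
    simpa using mul_le_of_le_one_right (Finset.sum_nonneg fun _ _ => norm_nonneg _)
      (inv_le_one_of_one_le₀ hs1)

theorem norm_ofReal_add_mul_I_le_exp {x c : ℝ} (hx : |x| ≤ c) (y : ℝ) :
    ‖(x : ℂ) + y * I‖ ≤ (c + 1) * Real.exp |y| := by
  calc ‖(x : ℂ) + y * I‖ ≤ |x| + |y| := by simpa using norm_le_abs_re_add_abs_im (x + y * I)
    _ ≤ c * Real.exp |y| + Real.exp |y| :=
        add_le_add (hx.trans (le_mul_of_one_le_right ((abs_nonneg x).trans hx)
          (Real.one_le_exp (abs_nonneg y))))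
          ((le_add_of_nonneg_right zero_le_one).trans (Real.add_one_le_exp _))
    _ = (c + 1) * Real.exp |y| := by ring

theorem exists_norm_zetaPowRegularPart_le_exp (k : ℕ) {σ : ℝ} (hσ : 0 < σ) (c : ℝ) :
    ∃ B : ℝ, ∀ x ∈ Icc σ c, ∀ y : ℝ, ‖zetaPowRegularPart k (x + y * I)‖ ≤
      B * Real.exp (k * |y|) := by
  have hcont : ContinuousOn (zetaPowRegularPart k) (Icc σ c ×ℂ Icc (-1 : ℝ) 1) :=
    (hasPoleExpansion_zetaPow k).differentiableOn.continuousOn.mono fun s hs =>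
      hσ.trans_le (mem_reProdIm.1 hs).1.1
  obtain ⟨B₀, hB₀⟩ := (isCompact_Icc.reProdIm isCompact_Icc).exists_bound_of_continuousOn hcont
  set A := ∑ j ∈ Finset.range k, ‖zetaPowPolarCoeff k j‖
  have hA : 0 ≤ A := Finset.sum_nonneg fun _ _ => norm_nonneg _
  refine ⟨max B₀ (((c + 1) * (1 + 1 / σ)) ^ k + A), fun x hx y => ?_⟩
  have hexp : 1 ≤ Real.exp (k * |y|) := Real.one_le_exp (by positivity)
  have hx0 : 0 < x := hσ.trans_le hx.1
  rcases le_total |y| 1 with hy | hy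
  · have hlow := hB₀ (x + y * I) (mem_reProdIm.2 ⟨by simpa using hx, by simpa using abs_le.1 hy⟩)
    exact (hlow.trans (le_mul_of_one_le_right ((norm_nonneg _).trans hlow) hexp)).trans
      (by gcongr; exact le_max_left _ _)
  · have hnorm := norm_ofReal_add_mul_I_le_exp (abs_le.2 ⟨by linarith [hx.2], hx.2⟩) y
    calc ‖zetaPowRegularPart k (x + y * I)‖
        ≤ (‖(x : ℂ) + y * I‖ * (1 + 1 / x)) ^ k + A := by
          simpa using norm_zetaPowRegularPart_le k (s := x + y * I) (by simpa) (by simpa)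
      _ ≤ ((c + 1) * Real.exp |y| * (1 + 1 / σ)) ^ k + A * Real.exp (k * |y|) := by
          gcongr
          · exact (norm_nonneg _).trans hnorm
          · exact hx.1
          · exact le_mul_of_one_le_right hA hexp
      _ = (((c + 1) * (1 + 1 / σ)) ^ k + A) * Real.exp (k * |y|) := by
          rw [mul_right_comm (c + 1), mul_pow, ← Real.exp_nat_mul, ← add_mul]
      _ ≤ _ := by gcongr; exact le_max_right _ _

theorem exists_norm_sq_zetaPowRegularPart_mul_le (k : ℕ) {σ : ℝ} (hσ : 0 < σ) (hσ1 : σ < 1) :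
    ∃ B : ℝ, ∀ y : ℝ,
      ‖zetaPowRegularPart k (σ + y * I)‖ ^ 2 * ‖(σ : ℂ) + y * I‖ ^ 2 ≤
        2 * ‖riemannZeta (σ + y * I)‖ ^ (2 * k) + B := by
  set M := ∑ j ∈ Finset.range k, ‖zetaPowPolarCoeff k j‖ * (1 - σ)⁻¹ ^ j
  have : 0 ≤ M := Finset.sum_nonneg fun j _ => by
    have := inv_nonneg.2 (sub_pos.2 hσ1).le
    positivity
  refine ⟨2 * (M * (1 + (1 - σ)⁻¹)) ^ 2, fun y => ?_⟩
  set s : ℂ := σ + y * I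
  have hre : s.re = σ := by simp [s]
  have hdist : 1 - σ ≤ ‖s - 1‖ := by
    have h := abs_re_le_norm (s - 1)
    rwa [sub_re, hre, one_re, abs_sub_comm, abs_of_pos (sub_pos.2 hσ1)] at h
  have hpos : 0 < ‖s - 1‖ := (sub_pos.2 hσ1).trans_le hdist
  have hs0 : s ≠ 0 := fun h => hσ.ne (by rw [← hre, h, zero_re])
  have hratio : ‖s - 1‖⁻¹ * ‖s‖ ≤ 1 + (1 - σ)⁻¹ := by
    calc ‖s - 1‖⁻¹ * ‖s‖ ≤ ‖s - 1‖⁻¹ * (‖s - 1‖ + 1) := by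
          gcongr
          simpa using norm_add_le (s - 1) 1
      _ = 1 + ‖s - 1‖⁻¹ := by field_simp
      _ ≤ 1 + (1 - σ)⁻¹ := by gcongr
  have hprincipal : ‖(∑ j ∈ Finset.range k, zetaPowPolarCoeff k j / (s - 1) ^ (j + 1)) * s‖ ≤
      M * (1 + (1 - σ)⁻¹) := by
    rw [norm_mul]
    calc _ ≤ M * ‖s - 1‖⁻¹ * ‖s‖ := by
          gcongr
          exact norm_sum_div_pow_le _ (sub_pos.2 hσ1) hdist
      _ ≤ _ := by rw [mul_assoc]; gcongr
  rw [← mul_pow, ← norm_mul, zetaPowRegularPart_eq_sub k (hre ▸ hσ)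
    (sub_ne_zero.1 (norm_pos_iff.1 hpos)), sub_mul, div_mul_cancel₀ _ hs0]
  calc _ ≤ (‖riemannZeta s‖ ^ k + M * (1 + (1 - σ)⁻¹)) ^ 2 := by
        gcongr
        exact (norm_sub_le _ _).trans (add_le_add (norm_pow_le _ _) hprincipal)
    _ ≤ 2 * ((‖riemannZeta s‖ ^ k) ^ 2 + (M * (1 + (1 - σ)⁻¹)) ^ 2) := add_sq_le
    _ = _ := by rw [← pow_mul, mul_comm k 2, mul_add]

/-! ### Laplace transform of the remainder in the divisor problem -/

theorem integrableOn_pow_mul_cexp_neg_mul (j : ℕ) {z : ℂ} (hz : 0 < z.re) :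
    IntegrableOn (fun w : ℝ => (w : ℂ) ^ j * exp (-z * w)) (Ioi 0) := by
  have h := integrableOn_rpow_mul_exp_neg_mul_rpow (p := 1) (s := (j : ℝ)) (b := z.re)
    (neg_one_lt_zero.trans_le j.cast_nonneg) one_pos hz
  refine h.mono' (Continuous.aestronglyMeasurable (by fun_prop)) ?_
  filter_upwards [ae_restrict_mem measurableSet_Ioi] with w hw
  rw [norm_mul, norm_pow, norm_real, Real.norm_of_nonneg (mem_Ioi.1 hw).le, norm_exp]
  simp

theorem tendsto_pow_mul_cexp_neg_mul_atTop (j : ℕ) {z : ℂ} (hz : 0 < z.re) :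
    Tendsto (fun w : ℝ => (w : ℂ) ^ j * exp (-z * w)) atTop (𝓝 0) := by
  rw [tendsto_zero_iff_norm_tendsto_zero]
  refine (tendsto_rpow_mul_exp_neg_mul_atTop_nhds_zero j z.re hz).congr' ?_
  filter_upwards [eventually_ge_atTop 0] with w hw
  rw [norm_mul, norm_pow, norm_real, Real.norm_of_nonneg hw, norm_exp]
  simp

theorem integral_pow_succ_mul_cexp_neg_mul (j : ℕ) {z : ℂ} (hz : 0 < z.re) :
    z * ∫ w in Ioi (0 : ℝ), (w : ℂ) ^ (j + 1) * exp (-z * w) =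
      (j + 1) * ∫ w in Ioi (0 : ℝ), (w : ℂ) ^ j * exp (-z * w) := by
  have hderiv : ∀ w ∈ Ici (0 : ℝ), HasDerivAt (fun w : ℝ => (w : ℂ) ^ (j + 1) * exp (-z * w))
      ((j + 1) * ((w : ℂ) ^ j * exp (-z * w)) - z * ((w : ℂ) ^ (j + 1) * exp (-z * w))) w := by
    intro w _
    have hid : HasDerivAt (fun w : ℝ => (w : ℂ)) 1 w := ofRealCLM.hasDerivAt
    refine ((hid.pow (j + 1)).mul (hid.const_mul (-z)).cexp).congr_deriv ?_
    simp only [Nat.add_sub_cancel, Nat.cast_add, Nat.cast_one, Pi.pow_apply]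
    ring
  have hlow := (integrableOn_pow_mul_cexp_neg_mul j hz).const_mul (j + 1 : ℂ)
  have hhigh := (integrableOn_pow_mul_cexp_neg_mul (j + 1) hz).const_mul z
  have hparts := integral_Ioi_of_hasDerivAt_of_tendsto' hderiv (hlow.sub hhigh)
    (tendsto_pow_mul_cexp_neg_mul_atTop (j + 1) hz)
  rw [integral_sub hlow hhigh, integral_const_mul, integral_const_mul, ofReal_zero,
    zero_pow j.succ_ne_zero, zero_mul, sub_zero] at hparts
  exact (sub_eq_zero.1 hparts).symm

theorem integral_pow_mul_cexp_neg_mul (j : ℕ) {z : ℂ} (hz : 0 < z.re) :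
    ∫ w in Ioi (0 : ℝ), (w : ℂ) ^ j * exp (-z * w) = j.factorial / z ^ (j + 1) := by
  have hz0 : z ≠ 0 := by
    rintro rfl
    simp at hz
  induction j with
  | zero =>
    simp only [pow_zero, one_mul]
    rw [integral_exp_mul_complex_Ioi (by simpa using hz)]
    simp
  | succ j ih =>
    have hrec := integral_pow_succ_mul_cexp_neg_mul j hz
    rw [ih, mul_comm, ← eq_div_iff hz0] at hrec
    rw [hrec, pow_succ z (j + 1), Nat.factorial_succ, ← div_div, mul_div_assoc]
    push_cast
    ring

theorem integrableOn_Ioi_mul_cexp_of_norm_le {f : ℝ → ℂ} (hf : Measurable f) {C b : ℝ}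
    (hb : ∀ w : ℝ, 0 < w → ‖f w‖ ≤ C * Real.exp (b * w)) {s : ℂ} (hs : b < s.re) :
    IntegrableOn (fun w : ℝ => f w * exp (-s * w)) (Ioi 0) := by
  refine ((integrableOn_exp_mul_Ioi (sub_neg.2 hs) 0).const_mul C).mono'
    (hf.mul (by fun_prop)).aestronglyMeasurable ?_
  filter_upwards [ae_restrict_mem measurableSet_Ioi] with w hw
  calc ‖f w * exp (-s * w)‖ = ‖f w‖ * Real.exp (-s.re * w) := by simp [norm_exp]
    _ ≤ C * Real.exp (b * w) * Real.exp (-s.re * w) := by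
        gcongr
        exact hb w hw
    _ = C * Real.exp ((b - s.re) * w) := by
        rw [mul_assoc, ← Real.exp_add]
        ring_nf

theorem measurable_sum_divisorFn_exp (k : ℕ) :
    Measurable fun w : ℝ => ∑ n ∈ Finset.Icc 1 ⌊Real.exp w⌋₊, (divisorFn k n : ℂ) :=
  (Measurable.of_discrete (f := fun N : ℕ => ∑ n ∈ Finset.Icc 1 N, (divisorFn k n : ℂ))).comp
    (Nat.measurable_floor.comp Real.measurable_exp)

theorem norm_sum_divisorFn_le (k N : ℕ) :
    ‖∑ n ∈ Finset.Icc 1 N, (divisorFn k n : ℂ)‖ ≤ (N : ℝ) ^ (k + 1) := by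
  rw [← Nat.cast_sum, norm_natCast]
  exact_mod_cast sum_divisorFn_le_pow k N

theorem norm_sum_divisorFn_exp_le (k : ℕ) {w : ℝ} (hw : 0 ≤ w) :
    ‖∑ n ∈ Finset.Icc 1 ⌊Real.exp w⌋₊, (divisorFn k n : ℂ)‖ ≤ Real.exp ((k + 2) * w) := by
  calc _ ≤ (⌊Real.exp w⌋₊ : ℝ) ^ (k + 1) := norm_sum_divisorFn_le k _
    _ ≤ Real.exp w ^ (k + 1) := by
        gcongr
        exact Nat.floor_le (Real.exp_pos w).le
    _ = Real.exp ((k + 1) * w) := by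
        rw [← Real.exp_nat_mul]
        simp
    _ ≤ Real.exp ((k + 2) * w) := by
        gcongr
        exact one_le_two

theorem integral_sum_divisorFn_mul_cexp (k : ℕ) {s : ℂ} (hs : k + 2 < s.re) :
    ∫ w in Ioi (0 : ℝ), (∑ n ∈ Finset.Icc 1 ⌊Real.exp w⌋₊, (divisorFn k n : ℂ)) *
      exp (-s * w) = riemannZeta s ^ k / s := by
  have : (0 : ℝ) ≤ k := k.cast_nonneg
  have hs0 : s ≠ 0 := by
    rintro rfl
    rw [zero_re] at hs
    linarith
  have hL := LSeriesHasSum_divisorFn k (s := s) (by linarith)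
  have hbigO : (fun N : ℕ => ∑ n ∈ Finset.Icc 1 N, (divisorFn k n : ℂ)) =O[atTop]
      fun N => (N : ℝ) ^ ((k + 1 : ℕ) : ℝ) :=
    IsBigO.of_bound 1 (Eventually.of_forall fun N => by
      simpa only [one_mul, Real.rpow_natCast, norm_pow, RCLike.norm_natCast] using
        norm_sum_divisorFn_le k N)
  rw [← hL.LSeries_eq, LSeries_eq_mul_integral _ (by positivity) (by push_cast; linarith)
    hL.LSeriesSummable hbigO, mul_div_cancel_left₀ _ hs0, ← Real.exp_zero, ← integral_comp_exp_Ioi]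
  refine setIntegral_congr_fun measurableSet_Ioi fun w _ => ?_
  rw [cpow_def_of_ne_zero (by simp), ← ofReal_log (Real.exp_pos w).le, Real.log_exp, real_smul,
    mul_left_comm, ofReal_exp, ← exp_add]
  congr 2
  ring

/-- The difference between `∑_{n ≤ e^w} d_k(n)` and `e^w ∑_{j < k} a_j w^j / j!`, whose real part
is the error term in the divisor problem at `e^w`. It is cut off to `w ≥ 0` so as to have a
Laplace transform over the whole line. -/
noncomputable def divisorRemainder (k : ℕ) (w : ℝ) : ℂ :=
  if w < 0 then 0 else
    ∑ n ∈ Finset.Icc 1 ⌊Real.exp w⌋₊, (divisorFn k n : ℂ) -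
      exp w * ∑ j ∈ Finset.range k, zetaPowPolarCoeff k j * (w : ℂ) ^ j / j.factorial

theorem measurable_divisorRemainder (k : ℕ) : Measurable (divisorRemainder k) :=
  Measurable.ite measurableSet_Iio measurable_const
    ((measurable_sum_divisorFn_exp k).sub (Continuous.measurable (by fun_prop)))

theorem divisorError_exp_eq_re_divisorRemainder (k : ℕ) {w : ℝ} (hw : 0 ≤ w) :
    divisorError k (Real.exp w) = (divisorRemainder k w).re := by
  rw [divisorError, divisorMainTerm_exp, divisorRemainder, if_neg hw.not_gt, sub_re, re_sum]
  simp only [natCast_re]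

theorem exists_norm_divisorRemainder_le (k : ℕ) :
    ∃ C : ℝ, ∀ w, ‖divisorRemainder k w‖ ≤ C * Real.exp ((k + 2) * w) := by
  set A := ∑ j ∈ Finset.range k, ‖zetaPowPolarCoeff k j‖
  have : 0 ≤ A := Finset.sum_nonneg fun _ _ => norm_nonneg _
  refine ⟨1 + A, fun w => ?_⟩
  rcases lt_or_ge w 0 with hw | hw
  · rw [divisorRemainder, if_pos hw, norm_zero]
    positivity
  have hpoly : ‖∑ j ∈ Finset.range k, zetaPowPolarCoeff k j * (w : ℂ) ^ j / j.factorial‖ ≤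
      A * Real.exp w := by
    rw [Finset.sum_mul]
    refine (norm_sum_le _ _).trans (Finset.sum_le_sum fun j _ => ?_)
    rw [mul_div_assoc, norm_mul, norm_div, norm_pow, norm_real, norm_natCast,
      Real.norm_of_nonneg hw]
    exact mul_le_mul_of_nonneg_left (Real.pow_div_factorial_le_exp w hw j) (norm_nonneg _)
  rw [divisorRemainder, if_neg hw.not_gt, add_mul, one_mul]
  refine (norm_sub_le _ _).trans (add_le_add (norm_sum_divisorFn_exp_le k hw) ?_)
  calc _ ≤ Real.exp w * (A * Real.exp w) := by
        rw [norm_mul, norm_exp, ofReal_re]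
        gcongr
    _ = A * Real.exp (2 * w) := by
        rw [two_mul, Real.exp_add]
        ring
    _ ≤ A * Real.exp ((k + 2) * w) := by
        gcongr
        exact le_add_of_nonneg_left k.cast_nonneg

theorem eventually_floor_exp_eq {w : ℝ} (hw : w ∉ range fun n : ℕ => Real.log n) :
    ∀ᶠ v in 𝓝 w, ⌊Real.exp v⌋₊ = ⌊Real.exp w⌋₊ := by
  have hlt : (⌊Real.exp w⌋₊ : ℝ) < Real.exp w :=
    (Nat.floor_le (Real.exp_pos w).le).lt_of_ne fun h => hw ⟨⌊Real.exp w⌋₊, by simp [h]⟩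
  filter_upwards [Real.continuous_exp.continuousAt.eventually
    (Ioo_mem_nhds hlt (Nat.lt_floor_add_one _))] with v hv
  exact (Nat.floor_eq_iff (Real.exp_pos v).le).2 ⟨hv.1.le, hv.2⟩

theorem ae_continuousAt_divisorRemainder (k : ℕ) : ∀ᵐ w, ContinuousAt (divisorRemainder k) w := by
  filter_upwards [(countable_range fun n : ℕ => Real.log n).ae_notMem volume] with w hw
  rcases lt_trichotomy w 0 with h | rfl | h
  · refine (continuousAt_const (y := (0 : ℂ))).congr ?_
    filter_upwards [Iio_mem_nhds h] with v hv
    rw [divisorRemainder, if_pos (mem_Iio.1 hv)]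
  · exact absurd ⟨1, by simp⟩ hw
  · have hcont : Continuous fun v : ℝ => ∑ n ∈ Finset.Icc 1 ⌊Real.exp w⌋₊, (divisorFn k n : ℂ) -
        exp v * ∑ j ∈ Finset.range k, zetaPowPolarCoeff k j * (v : ℂ) ^ j / j.factorial := by
      fun_prop
    refine hcont.continuousAt.congr ?_
    filter_upwards [eventually_floor_exp_eq hw, Ioi_mem_nhds h] with v hv hv0
    rw [divisorRemainder, if_neg (mem_Ioi.1 hv0).not_gt, hv]

theorem integral_divisorRemainder_mul_cexp (k : ℕ) {s : ℂ} (hs : k + 2 < s.re) :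
    ∫ w : ℝ, divisorRemainder k w * exp (-s * w) = zetaPowRegularPart k s := by
  have : (0 : ℝ) ≤ k := k.cast_nonneg
  have hs1 : s ≠ 1 := by
    rintro rfl
    rw [one_re] at hs
    linarith
  have hre : 0 < (s - 1).re := by
    rw [sub_re, one_re]
    linarith
  have hsupp : ∀ w ∉ Ici (0 : ℝ), divisorRemainder k w * exp (-s * w) = 0 := fun w hw => by
    rw [divisorRemainder, if_pos (not_le.1 hw), zero_mul]
  have hterm : ∀ j ∈ Finset.range k, IntegrableOn (fun w : ℝ =>
      zetaPowPolarCoeff k j / j.factorial * ((w : ℂ) ^ j * exp (-(s - 1) * w))) (Ioi 0) :=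
    fun j _ => (integrableOn_pow_mul_cexp_neg_mul j hre).const_mul _
  have hsplit : EqOn (fun w : ℝ => divisorRemainder k w * exp (-s * w))
      (fun w : ℝ => (∑ n ∈ Finset.Icc 1 ⌊Real.exp w⌋₊, (divisorFn k n : ℂ)) * exp (-s * w) -
        ∑ j ∈ Finset.range k,
          zetaPowPolarCoeff k j / j.factorial * ((w : ℂ) ^ j * exp (-(s - 1) * w)))
      (Ioi 0) := fun w hw => by
    simp only
    rw [divisorRemainder, if_neg (mem_Ioi.1 hw).not_gt, sub_mul, mul_right_comm, ← exp_add,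
      Finset.mul_sum]
    refine congrArg _ (Finset.sum_congr rfl fun j _ => ?_)
    rw [show (w : ℂ) + -s * w = -(s - 1) * w by ring]
    ring
  rw [← setIntegral_eq_integral_of_forall_compl_eq_zero hsupp, integral_Ici_eq_integral_Ioi,
    setIntegral_congr_fun measurableSet_Ioi hsplit, integral_sub
      (integrableOn_Ioi_mul_cexp_of_norm_le (C := 1) (measurable_sum_divisorFn_exp k)
        (fun w hw => by simpa using norm_sum_divisorFn_exp_le k hw.le) hs)
      (integrable_finsetSum _ hterm),
    integral_sum_divisorFn_mul_cexp k hs, integral_finsetSum _ hterm,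
    zetaPowRegularPart_eq_sub k (by linarith) hs1]
  refine congrArg _ (Finset.sum_congr rfl fun j _ => ?_)
  rw [integral_const_mul, integral_pow_mul_cexp_neg_mul j hre, div_mul_div_comm, mul_comm,
    mul_div_mul_left _ _ (Nat.cast_ne_zero.2 j.factorial_ne_zero)]

/-! ### Plancherel's theorem -/

section Plancherel

variable {V F : Type*} [NormedAddCommGroup V] [InnerProductSpace ℝ V] [FiniteDimensional ℝ V]
  [MeasurableSpace V] [BorelSpace V] [NormedAddCommGroup F] [InnerProductSpace ℂ F]
  [CompleteSpace F] {f : V → F}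

theorem fourier_toLp_ae_eq (hf : Integrable f) (hf2 : MemLp f 2) :
    (𝓕 (hf2.toLp f) : Lp F 2 (volume : Measure V)) =ᵐ[volume] 𝓕 f := by
  have hcont : Continuous (𝓕 f) := VectorFourier.fourierIntegral_continuous
    Real.continuous_fourierChar (L := innerₗ V) continuous_inner hf
  refine ae_eq_of_integral_contDiff_smul_eq ((Lp.memLp _).locallyIntegrable one_le_two)
    hcont.locallyIntegrable fun g hg hgs => ?_
  have hgs' : HasCompactSupport (ofRealCLM ∘ g) := hgs.comp_left rfl
  have hg' : ContDiff ℝ ∞ (ofRealCLM ∘ g) := by fun_prop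
  set φ := hgs'.toSchwartzMap hg'
  calc ∫ x, g x • (𝓕 (hf2.toLp f) : Lp F 2 (volume : Measure V)) x
      = ((𝓕 (hf2.toLp f) : Lp F 2 (volume : Measure V)) : TemperedDistribution V F) φ := by
        simp [φ]
    _ = ((hf2.toLp f : Lp F 2 (volume : Measure V)) : TemperedDistribution V F) (𝓕 φ) := by
        rw [← Lp.fourier_toTemperedDistribution_eq, TemperedDistribution.fourier_apply]
    _ = ∫ x, (𝓕 φ) x • f x := by
        rw [Lp.toTemperedDistribution_apply]
        refine integral_congr_ae ?_
        filter_upwards [hf2.coeFn_toLp] with x hx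
        rw [hx]
    _ = ∫ x, φ x • 𝓕 f x := by
        simpa using! VectorFourier.integral_fourierIntegral_smul_eq_flip (L := innerₗ V)
          Real.continuous_fourierChar continuous_inner φ.integrable hf
    _ = ∫ x, g x • 𝓕 f x := by simp [φ]

theorem eLpNorm_fourier (hf : Integrable f) (hf2 : MemLp f 2) :
    eLpNorm (𝓕 f) 2 volume = eLpNorm f 2 volume := by
  rw [← eLpNorm_congr_ae (fourier_toLp_ae_eq hf hf2), ← Lp.enorm_def, ← Lp.enorm_toLp hf2,
    ← ofReal_norm, ← ofReal_norm, Lp.norm_fourier_eq]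

end Plancherel

theorem lintegral_comp_mul_left_real (f : ℝ → ENNReal) {a : ℝ} (ha : a ≠ 0) :
    ∫⁻ x, f (a * x) = ENNReal.ofReal |a⁻¹| * ∫⁻ x, f x := by
  rw [← smul_eq_mul, ← lintegral_smul_measure, ← Real.map_volume_mul_left ha,
    (measurableEmbedding_mulLeft₀ ha).lintegral_map]

theorem lintegral_enorm_sq_integral_mul_cexp {f : ℝ → ℂ} (hf : Integrable f) (hf2 : MemLp f 2) :
    ∫⁻ u : ℝ, ‖∫ y, f y * exp (y * u * I)‖ₑ ^ 2 =
      ENNReal.ofReal (2 * Real.pi) * ∫⁻ y, ‖f y‖ₑ ^ 2 := by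
  have hfourier : ∀ u : ℝ, ∫ y, f y * exp (y * u * I) = 𝓕 f (-(2 * Real.pi)⁻¹ * u) := by
    intro u
    rw [Real.fourier_real_eq_integral_exp_smul]
    refine integral_congr_ae (Eventually.of_forall fun y => ?_)
    simp only [smul_eq_mul, mul_comm (f y)]
    congr 3
    push_cast
    field_simp
  have hplancherel : ∫⁻ x, ‖𝓕 f x‖ₑ ^ 2 = ∫⁻ y, ‖f y‖ₑ ^ 2 := by
    have hsq := congrArg (· ^ 2) (eLpNorm_fourier hf hf2)
    have hpow : ∀ g : ℝ → ℂ, eLpNorm g 2 volume ^ 2 = ∫⁻ y, ‖g y‖ₑ ^ 2 := fun g => by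
      simpa using eLpNorm_nnreal_pow_eq_lintegral (f := g) (μ := volume) (p := 2) two_ne_zero
    simpa only [hpow] using hsq
  simp_rw [hfourier]
  rw [lintegral_comp_mul_left_real (fun x => ‖𝓕 f x‖ₑ ^ 2) (by simp [Real.pi_ne_zero]), hplancherel]
  congr 2
  rw [inv_neg, inv_inv, abs_neg, abs_of_pos Real.two_pi_pos]

/-! ### Gaussian regularisation of a Laplace transform -/

theorem integral_vertical_eq_of_norm_le {G : ℂ → ℂ} {a b : ℝ} (hab : a ≤ b)
    (hG : DifferentiableOn ℂ G (Icc a b ×ℂ univ)) {m : ℝ → ℝ} (hm : Integrable m)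
    (hm0 : Tendsto m (cocompact ℝ) (𝓝 0))
    (hle : ∀ x ∈ Icc a b, ∀ y : ℝ, ‖G (x + y * I)‖ ≤ m y) :
    ∫ y : ℝ, G (a + y * I) = ∫ y : ℝ, G (b + y * I) := by
  have hint : ∀ x ∈ Icc a b, Integrable fun y : ℝ => G (x + y * I) := fun x hx =>
    hm.mono' (hG.continuousOn.comp_continuous (by fun_prop) fun y => by
      simpa [mem_reProdIm] using hx).aestronglyMeasurable (Eventually.of_forall (hle x hx))
  have htop : Tendsto (fun n : ℕ => (n : ℝ)) atTop atTop := tendsto_natCast_atTop_atTop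
  have hbot : Tendsto (fun n : ℕ => -(n : ℝ)) atTop atBot := tendsto_neg_atTop_atBot.comp htop
  have hvert : ∀ x ∈ Icc a b, Tendsto (fun n : ℕ => ∫ y in (-(n : ℝ))..n, G (x + y * I))
      atTop (𝓝 (∫ y : ℝ, G (x + y * I))) := fun x hx =>
    intervalIntegral_tendsto_integral (hint x hx) hbot htop
  have hhoriz : ∀ φ : ℕ → ℝ, Tendsto φ atTop (cocompact ℝ) →
      Tendsto (fun n : ℕ => ∫ x in a..b, G (x + φ n * I)) atTop (𝓝 0) := by
    intro φ hφ
    refine squeeze_zero_norm (a := fun n => m (φ n) * |b - a|) (fun n => ?_)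
      (by simpa using (hm0.comp hφ).mul_const |b - a|)
    refine intervalIntegral.norm_integral_le_of_norm_le_const fun x hx => hle x ?_ _
    rw [uIoc_of_le hab] at hx
    exact Ioc_subset_Icc_self hx
  have hrect : ∀ n : ℕ, (∫ x in a..b, G (x + (-(n : ℝ) : ℝ) * I)) -
      (∫ x in a..b, G (x + (n : ℝ) * I)) + I • (∫ y in (-(n : ℝ))..n, G (b + y * I)) -
      I • (∫ y in (-(n : ℝ))..n, G (a + y * I)) = 0 := fun n =>
    integral_boundary_rect_eq_zero_of_differentiableOn G (⟨a, -(n : ℝ)⟩ : ℂ) (⟨b, n⟩ : ℂ)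
      (hG.mono (reProdIm_subset_iff.2 (prod_mono (uIcc_of_le hab).le (subset_univ _))))
  have hlim := (((hhoriz _ (hbot.mono_right atBot_le_cocompact)).sub
    (hhoriz _ (htop.mono_right atTop_le_cocompact))).add
    ((hvert b ⟨hab, le_rfl⟩).const_smul I)).sub ((hvert a ⟨le_rfl, hab⟩).const_smul I)
  have h0 := tendsto_nhds_unique (hlim.congr hrect) tendsto_const_nhds
  rw [sub_zero, zero_add, ← smul_sub] at h0
  exact (sub_eq_zero.1 ((smul_eq_zero.1 h0).resolve_left I_ne_zero)).symm

theorem tendsto_exp_neg_mul_sq_cocompact {δ : ℝ} (hδ : 0 < δ) :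
    Tendsto (fun y : ℝ => Real.exp (-δ * y ^ 2)) (cocompact ℝ) (𝓝 0) := by
  have h : Tendsto (fun y : ℝ => δ * ‖y‖ ^ 2) (cocompact ℝ) atTop :=
    ((tendsto_pow_atTop two_ne_zero).comp tendsto_norm_cocompact_atTop).const_mul_atTop hδ
  refine (Real.tendsto_exp_neg_atTop_nhds_zero.comp h).congr fun y => ?_
  simp

theorem norm_cexp_gaussian (v x y u : ℝ) :
    ‖exp (v / 2 * (x + y * I) ^ 2 + (x + y * I) * u)‖ =
      Real.exp (v / 2 * (x ^ 2 - y ^ 2) + x * u) := by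
  rw [norm_exp, ← ofReal_ofNat, ← ofReal_div, add_re, re_ofReal_mul]
  simp [sq]

theorem exists_norm_mul_cexp_gaussian_le {H : ℂ → ℂ} {σ c A B : ℝ}
    (hH : ∀ x ∈ Icc σ c, ∀ y : ℝ, ‖H (x + y * I)‖ ≤ B * Real.exp (A * |y|))
    {v : ℝ} (hv : 0 < v) (u : ℝ) :
    ∃ C : ℝ, ∀ x ∈ Icc σ c, ∀ y : ℝ,
      ‖H (x + y * I) * exp (v / 2 * (x + y * I) ^ 2 + (x + y * I) * u)‖ ≤
        C * Real.exp (-(v / 4) * y ^ 2) := by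
  obtain ⟨R, hR⟩ := isCompact_Icc.exists_bound_of_continuousOn
    (f := fun x : ℝ => v / 2 * x ^ 2 + x * u) (s := Icc σ c) (by fun_prop)
  refine ⟨|B| * Real.exp (A ^ 2 / v + R), fun x hx y => ?_⟩
  have hx' : v / 2 * x ^ 2 + x * u ≤ R := (le_abs_self _).trans (hR x hx)
  have hsq : A * |y| ≤ A ^ 2 / v + v / 4 * y ^ 2 := by
    have e : (A / √v - √v / 2 * |y|) ^ 2 = A ^ 2 / v + v / 4 * y ^ 2 - A * |y| := by
      have := Real.sqrt_ne_zero'.2 hv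
      rw [sub_sq, div_pow, mul_pow, div_pow, Real.sq_sqrt hv.le, sq_abs]
      field_simp
      ring
    linarith [sq_nonneg (A / √v - √v / 2 * |y|)]
  rw [norm_mul, norm_cexp_gaussian]
  calc ‖H (x + y * I)‖ * Real.exp (v / 2 * (x ^ 2 - y ^ 2) + x * u)
      ≤ |B| * Real.exp (A * |y|) * Real.exp (v / 2 * (x ^ 2 - y ^ 2) + x * u) := by
        gcongr
        exact (hH x hx y).trans (by gcongr; exact le_abs_self B)
    _ = |B| * Real.exp (A * |y| + (v / 2 * (x ^ 2 - y ^ 2) + x * u)) := by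
        rw [mul_assoc, ← Real.exp_add]
    _ ≤ |B| * Real.exp (A ^ 2 / v + R + -(v / 4) * y ^ 2) := by
        gcongr |B| * Real.exp ?_
        linarith
    _ = _ := by rw [Real.exp_add, mul_assoc]

theorem integral_cexp_gaussian {v : ℝ≥0} (hv : v ≠ 0) (c u w : ℝ) :
    ∫ y : ℝ, exp (v / 2 * (c + y * I) ^ 2 + (c + y * I) * (u - w)) =
      (2 * Real.pi * gaussianPDFReal u v w : ℝ) := by
  have hv' : (v : ℂ) ≠ 0 := by exact_mod_cast hv
  have hv0 : (0 : ℝ) < v := by positivity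
  have hquad : ∀ y : ℝ, exp (v / 2 * (c + y * I) ^ 2 + (c + y * I) * (u - w)) =
      exp (-(v / 2) * y ^ 2 + I * (v * c + (u - w)) * y + (v / 2 * c ^ 2 + c * (u - w))) := by
    intro y
    congr 1
    linear_combination (v / 2 * y ^ 2 : ℂ) * I_sq
  have hsqrt : (Real.pi / (v / 2) : ℂ) ^ (1 / 2 : ℂ) =
      (2 * Real.pi * (√(2 * Real.pi * v))⁻¹ : ℝ) := by
    have hreal : 2 * Real.pi * (√(2 * Real.pi * v))⁻¹ = (Real.pi / (v / 2)) ^ (1 / 2 : ℝ) := by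
      rw [← Real.sqrt_eq_rpow, ← div_eq_mul_inv, div_eq_iff (by positivity),
        ← Real.sqrt_mul (by positivity), eq_comm, Real.sqrt_eq_iff_mul_self_eq (by positivity)
        (by positivity)]
      field_simp
    rw [hreal, ofReal_cpow (by positivity)]
    push_cast
    rfl
  have hint := integral_cexp_quadratic (b := -(v / 2 : ℂ)) (by simpa [← ofReal_ofNat] using hv0)
    (I * (v * c + (u - w))) (v / 2 * c ^ 2 + c * (u - w))
  simp_rw [hquad]
  rw [hint, neg_neg, hsqrt, gaussianPDFReal_def, ← mul_assoc, ofReal_mul _ (Real.exp _), ofReal_exp]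
  congr 2
  push_cast
  field_simp
  linear_combination (4 * (v * c + (u - w)) ^ 2 : ℂ) * I_sq

theorem integral_gaussianReal_eq_integral_standard {f : ℝ → ℂ} (hf : Measurable f) (u : ℝ)
    (v : ℝ≥0) :
    ∫ w, f w ∂gaussianReal u v = ∫ y, f (NNReal.sqrt v * y + u) ∂gaussianReal 0 1 := by
  have hstd : gaussianReal u v =
      (gaussianReal 0 1).map ((· + u) ∘ ((NNReal.sqrt v : ℝ) * ·)) := by
    rw [← Measure.map_map (by fun_prop) (by fun_prop), gaussianReal_map_const_mul,
      gaussianReal_map_add_const]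
    congr 1
    · simp
    · ext; simp
  rw [hstd, integral_map (by fun_prop) hf.aestronglyMeasurable]
  rfl

theorem measurable_integral_gaussianReal {f : ℝ → ℂ} (hf : Measurable f) (v : ℝ≥0) :
    Measurable fun u : ℝ => ∫ w, f w ∂gaussianReal u v := by
  simp_rw [integral_gaussianReal_eq_integral_standard hf]
  have hjoint : Measurable fun p : ℝ × ℝ => f (NNReal.sqrt v * p.2 + p.1) :=
    hf.comp (by fun_prop)
  exact hjoint.stronglyMeasurable.integral_prod_right'.measurable

theorem tendsto_integral_gaussianReal {f : ℝ → ℂ} (hf : Measurable f) {C b : ℝ}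
    (hle : ∀ w, ‖f w‖ ≤ C * Real.exp (b * |w|)) {u : ℝ} (hu : ContinuousAt f u) :
    Tendsto (fun v : ℝ≥0 => ∫ w, f w ∂gaussianReal u v) (𝓝 0) (𝓝 (f u)) := by
  have hC : 0 ≤ C := by simpa using (norm_nonneg _).trans (hle 0)
  simp_rw [integral_gaussianReal_eq_integral_standard hf]
  have hconst : f u = ∫ _, f u ∂gaussianReal 0 1 := by simp
  rw [hconst]
  refine tendsto_integral_filter_of_dominated_convergence
    (fun y => C * Real.exp (|b| * |u|) * Real.exp (|b| * |y|)) ?_ ?_ ?_ ?_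
  · exact Eventually.of_forall fun v => (hf.comp (by fun_prop)).aestronglyMeasurable
  · filter_upwards [Iic_mem_nhds (zero_lt_one' ℝ≥0)] with v hv
    refine Eventually.of_forall fun y => (hle _).trans ?_
    rw [mul_assoc, ← Real.exp_add]
    have hv1 : (NNReal.sqrt v : ℝ) ≤ 1 := by
      exact_mod_cast NNReal.sqrt_le_one.2 hv
    gcongr C * Real.exp ?_
    calc b * |NNReal.sqrt v * y + u| ≤ |b| * (|NNReal.sqrt v * y| + |u|) := by
          gcongr
          · exact le_abs_self b
          · exact abs_add_le _ _
      _ ≤ |b| * (1 * |y| + |u|) := by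
          rw [abs_mul, NNReal.abs_eq]
          gcongr
      _ = |b| * |u| + |b| * |y| := by ring
  · exact (integrable_exp_mul_abs (integrable_exp_mul_gaussianReal |b|)
      (integrable_exp_mul_gaussianReal (-|b|))).const_mul _
  · refine Eventually.of_forall fun y => hu.tendsto.comp ?_
    have hlim : Tendsto (fun v : ℝ≥0 => (NNReal.sqrt v : ℝ) * y + u) (𝓝 0)
        (𝓝 ((NNReal.sqrt 0 : ℝ) * y + u)) := Continuous.tendsto (by fun_prop) 0
    simpa using hlim

theorem lintegral_le_of_ae_tendsto {α ι : Type*} [MeasurableSpace α] {μ : Measure α}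
    {l : Filter ι} [l.IsCountablyGenerated] [l.NeBot] {f : ι → α → ENNReal} {g : α → ENNReal}
    {C : ENNReal} (hf : ∀ i, Measurable (f i))
    (hlim : ∀ᵐ x ∂μ, Tendsto (fun i => f i x) l (𝓝 (g x)))
    (hC : ∃ᶠ i in l, ∫⁻ x, f i x ∂μ ≤ C) : ∫⁻ x, g x ∂μ ≤ C :=
  calc ∫⁻ x, g x ∂μ = ∫⁻ x, liminf (fun i => f i x) l ∂μ :=
        lintegral_congr_ae (hlim.mono fun _ hx => hx.liminf_eq.symm)
    _ ≤ liminf (fun i => ∫⁻ x, f i x ∂μ) l := lintegral_liminf_le hf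
    _ ≤ C := liminf_le_of_frequently_le' hC

theorem enorm_sq_cexp_gaussian_le {v : ℝ≥0} (hv : v ≤ 1) (x y : ℝ) :
    ‖exp (v / 2 * (x + y * I) ^ 2)‖ₑ ^ 2 ≤ ENNReal.ofReal (Real.exp (x ^ 2)) := by
  have hnorm := norm_cexp_gaussian v x y 0
  rw [ofReal_zero, mul_zero, add_zero, mul_zero, add_zero] at hnorm
  rw [← ofReal_norm, ← ENNReal.ofReal_pow (norm_nonneg _), hnorm, ← Real.exp_nat_mul]
  refine ENNReal.ofReal_le_ofReal (Real.exp_le_exp.2 ?_)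
  have : (v : ℝ) ≤ 1 := hv
  push_cast
  nlinarith [sq_nonneg x, mul_nonneg v.coe_nonneg (sq_nonneg y)]

/-- `H` continues the two-sided Laplace transform of `E` from the line `re s = c`, where the
transform converges absolutely, to the strip `σ ≤ re s ≤ c`, with at most exponential vertical
growth. -/
structure IsLaplaceContinuation (E : ℝ → ℂ) (H : ℂ → ℂ) (σ c : ℝ) : Prop where
  le : σ ≤ c
  integrable : Integrable fun w : ℝ => E w * exp (-c * w)
  integral_eq : ∀ y : ℝ, ∫ w : ℝ, E w * exp (-(c + y * I) * w) = H (c + y * I)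
  differentiableOn : DifferentiableOn ℂ H (Icc σ c ×ℂ univ)
  exists_norm_le : ∃ A B : ℝ, ∀ x ∈ Icc σ c, ∀ y : ℝ, ‖H (x + y * I)‖ ≤ B * Real.exp (A * |y|)

/-- The mean square of `u ↦ E (u + b) - E u` with respect to the weight `exp (-2 * σ * u)`. -/
noncomputable def shiftMeanSquare (E : ℝ → ℂ) (σ b : ℝ) : ENNReal :=
  ∫⁻ u : ℝ, ‖E (u + b) - E u‖ₑ ^ 2 * ENNReal.ofReal (Real.exp (-2 * σ * u))

namespace IsLaplaceContinuation

variable {E : ℝ → ℂ} {H : ℂ → ℂ} {σ c : ℝ}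

theorem continuous_vertical (h : IsLaplaceContinuation E H σ c) :
    Continuous fun y : ℝ => H (σ + y * I) :=
  h.differentiableOn.continuousOn.comp_continuous (by fun_prop) fun y => by
    simpa [mem_reProdIm] using h.le

theorem integral_mul_cexp_gaussian_right (h : IsLaplaceContinuation E H σ c) {v : ℝ≥0}
    (hv : v ≠ 0) (u : ℝ) :
    ∫ y : ℝ, H (c + y * I) * exp (v / 2 * (c + y * I) ^ 2 + (c + y * I) * u) =
      2 * Real.pi * ∫ w, E w ∂gaussianReal u v := by
  have hgauss : Integrable fun y : ℝ => exp (v / 2 * (c + y * I) ^ 2 + (c + y * I) * u) := by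
    obtain ⟨C, hC⟩ := exists_norm_mul_cexp_gaussian_le (H := 1) (σ := c) (c := c) (A := 0) (B := 1)
      (by simp) (v := v) (by positivity) u
    refine ((integrable_exp_neg_mul_sq (b := (v / 4 : ℝ)) (by positivity)).const_mul C).mono'
      (by fun_prop) (Eventually.of_forall fun y => ?_)
    simpa using hC c ⟨le_rfl, le_rfl⟩ y
  have hinner : ∀ y : ℝ, H (c + y * I) * exp (v / 2 * (c + y * I) ^ 2 + (c + y * I) * u) =
      ∫ w : ℝ, E w * exp (v / 2 * (c + y * I) ^ 2 + (c + y * I) * (u - w)) := by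
    intro y
    rw [← h.integral_eq, ← integral_mul_const]
    refine integral_congr_ae (Eventually.of_forall fun w => ?_)
    simp only [mul_assoc (E w), ← exp_add]
    ring_nf
  simp_rw [hinner]
  rw [integral_integral_swap]
  · rw [integral_gaussianReal_eq_integral_smul hv, ← integral_const_mul]
    refine integral_congr_ae (Eventually.of_forall fun w => ?_)
    simp only [integral_const_mul, integral_cexp_gaussian hv, real_smul]
    push_cast
    ring
  · refine ((hgauss.mul_prod h.integrable).bdd_mul (c := 1)
      (f := fun q : ℝ × ℝ => exp (I * (-q.1 : ℝ) * q.2)) (by fun_prop)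
      (Eventually.of_forall fun q => ?_)).congr (Eventually.of_forall fun q => ?_)
    · simp [norm_exp]
    · simp only [Function.uncurry, mul_left_comm (exp _) (E q.2), ← exp_add]
      push_cast
      ring_nf

theorem exists_norm_mul_cexp_gaussian_le (h : IsLaplaceContinuation E H σ c) {v : ℝ} (hv : 0 < v)
    (u : ℝ) :
    ∃ C : ℝ, ∀ x ∈ Icc σ c, ∀ y : ℝ,
      ‖H (x + y * I) * exp (v / 2 * (x + y * I) ^ 2 + (x + y * I) * u)‖ ≤
        C * Real.exp (-(v / 4) * y ^ 2) := by
  obtain ⟨A, B, hAB⟩ := h.exists_norm_le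
  exact _root_.exists_norm_mul_cexp_gaussian_le hAB hv u

theorem integral_mul_cexp_gaussian (h : IsLaplaceContinuation E H σ c) {v : ℝ≥0} (hv : v ≠ 0)
    (u : ℝ) :
    ∫ y : ℝ, H (σ + y * I) * exp (v / 2 * (σ + y * I) ^ 2 + (σ + y * I) * u) =
      2 * Real.pi * ∫ w, E w ∂gaussianReal u v := by
  have hv' : (0 : ℝ) < v := by positivity
  obtain ⟨C, hC⟩ := h.exists_norm_mul_cexp_gaussian_le hv' u
  rw [← h.integral_mul_cexp_gaussian_right hv u]
  have hv4 : (0 : ℝ) < v / 4 := by positivity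
  exact integral_vertical_eq_of_norm_le
    (G := fun s => H s * exp (v / 2 * s ^ 2 + s * u)) h.le
    (h.differentiableOn.mul (Differentiable.differentiableOn (by fun_prop)))
    ((integrable_exp_neg_mul_sq hv4).const_mul C)
    (by simpa using (tendsto_exp_neg_mul_sq_cocompact hv4).const_mul C) hC

theorem integrable_mul_cexp_gaussian (h : IsLaplaceContinuation E H σ c) {v : ℝ} (hv : 0 < v)
    (u : ℝ) :
    Integrable fun y : ℝ => H (σ + y * I) * exp (v / 2 * (σ + y * I) ^ 2 + (σ + y * I) * u) := by
  obtain ⟨C, hC⟩ := h.exists_norm_mul_cexp_gaussian_le hv u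
  exact ((integrable_exp_neg_mul_sq (by positivity)).const_mul C).mono'
    (h.continuous_vertical.mul (by fun_prop)).aestronglyMeasurable
    (Eventually.of_forall fun y => hC σ ⟨le_rfl, h.le⟩ y)

theorem memLp_two_mul_cexp_gaussian (h : IsLaplaceContinuation E H σ c) {v : ℝ} (hv : 0 < v)
    (u : ℝ) :
    MemLp (fun y : ℝ => H (σ + y * I) * exp (v / 2 * (σ + y * I) ^ 2 + (σ + y * I) * u)) 2 := by
  obtain ⟨C, hC⟩ := h.exists_norm_mul_cexp_gaussian_le hv u
  have hint := h.integrable_mul_cexp_gaussian hv u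
  refine (memLp_two_iff_integrable_sq_norm hint.aestronglyMeasurable).2 ?_
  refine (hint.norm.bdd_mul hint.norm.aestronglyMeasurable (c := |C|)
    (Eventually.of_forall fun y => ?_)).congr (Eventually.of_forall fun y => (sq _).symm)
  rw [norm_norm]
  refine (hC σ ⟨le_rfl, h.le⟩ y).trans ((mul_le_mul_of_nonneg_right (le_abs_self C)
    (Real.exp_pos _).le).trans (mul_le_of_le_one_right (abs_nonneg C) (Real.exp_le_one_iff.2 ?_)))
  nlinarith [sq_nonneg y]

theorem integral_mul_sub_mul_cexp (h : IsLaplaceContinuation E H σ c) {v : ℝ≥0} (hv : v ≠ 0)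
    (b u : ℝ) :
    ∫ y : ℝ, H (σ + y * I) * (exp (b * (σ + y * I)) - 1) * exp (v / 2 * (σ + y * I) ^ 2) *
        exp (y * u * I) =
      2 * Real.pi * exp (-σ * u) *
        (∫ w, E w ∂gaussianReal (u + b) v - ∫ w, E w ∂gaussianReal u v) := by
  have hv' : (0 : ℝ) < v := by positivity
  rw [mul_right_comm, mul_sub, ← h.integral_mul_cexp_gaussian hv,
    ← h.integral_mul_cexp_gaussian hv, ← integral_sub (h.integrable_mul_cexp_gaussian hv' _)
    (h.integrable_mul_cexp_gaussian hv' _), ← integral_mul_const]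
  refine integral_congr_ae (Eventually.of_forall fun y => ?_)
  have hsplit : exp (v / 2 * (σ + y * I) ^ 2 + (σ + y * I) * (u + b : ℝ)) * exp (-σ * u) =
      exp (b * (σ + y * I)) * exp (v / 2 * (σ + y * I) ^ 2) * exp (y * u * I) := by
    simp only [← exp_add]
    push_cast
    ring_nf
  have hsplit' : exp (v / 2 * (σ + y * I) ^ 2 + (σ + y * I) * u) * exp (-σ * u) =
      exp (v / 2 * (σ + y * I) ^ 2) * exp (y * u * I) := by
    simp only [← exp_add]
    ring_nf
  linear_combination -(H (σ + y * I)) * hsplit + H (σ + y * I) * hsplit'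

theorem integrable_and_memLp_two_mul_sub_mul_cexp (h : IsLaplaceContinuation E H σ c) {v : ℝ}
    (hv : 0 < v) (b : ℝ) :
    Integrable (fun y : ℝ =>
        H (σ + y * I) * (exp (b * (σ + y * I)) - 1) * exp (v / 2 * (σ + y * I) ^ 2)) ∧
      MemLp (fun y : ℝ =>
        H (σ + y * I) * (exp (b * (σ + y * I)) - 1) * exp (v / 2 * (σ + y * I) ^ 2)) 2 := by
  have hsub : (fun y : ℝ =>
        H (σ + y * I) * (exp (b * (σ + y * I)) - 1) * exp (v / 2 * (σ + y * I) ^ 2)) =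
      (fun y : ℝ => H (σ + y * I) * exp (v / 2 * (σ + y * I) ^ 2 + (σ + y * I) * b)) -
        fun y : ℝ => H (σ + y * I) * exp (v / 2 * (σ + y * I) ^ 2 + (σ + y * I) * (0 : ℝ)) := by
    funext y
    simp only [Pi.sub_apply, exp_add, ofReal_zero, mul_zero, exp_zero, mul_comm (b : ℂ)]
    ring
  rw [hsub]
  exact ⟨(h.integrable_mul_cexp_gaussian hv b).sub (h.integrable_mul_cexp_gaussian hv 0),
    (h.memLp_two_mul_cexp_gaussian hv b).sub (h.memLp_two_mul_cexp_gaussian hv 0)⟩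

theorem lintegral_enorm_sq_gaussian_sub_le (h : IsLaplaceContinuation E H σ c) {v : ℝ≥0}
    (hv : v ≠ 0) (hv1 : v ≤ 1) (b : ℝ) :
    ∫⁻ u : ℝ, ‖∫ w, E w ∂gaussianReal (u + b) v - ∫ w, E w ∂gaussianReal u v‖ₑ ^ 2 *
        ENNReal.ofReal (Real.exp (-2 * σ * u)) ≤
      ENNReal.ofReal (Real.exp (σ ^ 2)) *
        ∫⁻ y : ℝ, ‖H (σ + y * I) * (exp (b * (σ + y * I)) - 1)‖ₑ ^ 2 := by
  obtain ⟨hint, hmem⟩ :=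
    h.integrable_and_memLp_two_mul_sub_mul_cexp (v := v) (by positivity) b
  have hpi : 1 ≤ ENNReal.ofReal (2 * Real.pi) :=
    ENNReal.one_le_ofReal.2 (by linarith [Real.pi_gt_three])
  have hweight : ∀ u : ℝ, ‖exp (-σ * u)‖ₑ ^ 2 = ENNReal.ofReal (Real.exp (-2 * σ * u)) := by
    intro u
    rw [← ofReal_norm, ← ENNReal.ofReal_pow (norm_nonneg _), norm_exp, ← Real.exp_nat_mul]
    congr 2
    simp
    ring
  have hpi_ne : ENNReal.ofReal (2 * Real.pi) ≠ ⊤ := ENNReal.ofReal_ne_top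
  rw [← ENNReal.mul_le_mul_iff_right (a := ENNReal.ofReal (2 * Real.pi)) (by positivity) hpi_ne]
  calc ENNReal.ofReal (2 * Real.pi) *
        ∫⁻ u : ℝ, ‖∫ w, E w ∂gaussianReal (u + b) v - ∫ w, E w ∂gaussianReal u v‖ₑ ^ 2 *
          ENNReal.ofReal (Real.exp (-2 * σ * u))
      ≤ ∫⁻ u : ℝ, ‖∫ y : ℝ, H (σ + y * I) * (exp (b * (σ + y * I)) - 1) *
          exp (v / 2 * (σ + y * I) ^ 2) * exp (y * u * I)‖ₑ ^ 2 := by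
        rw [← lintegral_const_mul' _ _ hpi_ne]
        refine lintegral_mono fun u => ?_
        have hnorm : ‖(2 * Real.pi : ℂ)‖ₑ = ENNReal.ofReal (2 * Real.pi) := by
          rw [← ofReal_norm]
          simp [abs_of_pos Real.pi_pos]
        rw [h.integral_mul_sub_mul_cexp hv, enorm_mul, enorm_mul, mul_pow, mul_pow, hweight, hnorm,
          mul_right_comm (ENNReal.ofReal _ ^ 2), mul_assoc (ENNReal.ofReal _ ^ 2)]
        gcongr
        exact le_self_pow hpi two_ne_zero
    _ = ENNReal.ofReal (2 * Real.pi) * ∫⁻ y : ℝ, ‖H (σ + y * I) * (exp (b * (σ + y * I)) - 1) *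
          exp (v / 2 * (σ + y * I) ^ 2)‖ₑ ^ 2 := lintegral_enorm_sq_integral_mul_cexp hint hmem
    _ ≤ _ := by
        gcongr
        rw [← lintegral_const_mul' _ _ ENNReal.ofReal_ne_top]
        refine lintegral_mono fun y => ?_
        rw [enorm_mul, mul_pow, mul_comm]
        exact mul_le_mul_left (enorm_sq_cexp_gaussian_le hv1 σ y) _

theorem shiftMeanSquare_le (h : IsLaplaceContinuation E H σ c) (hE : Measurable E) {C β : ℝ}
    (hle : ∀ w, ‖E w‖ ≤ C * Real.exp (β * |w|)) (hcont : ∀ᵐ w : ℝ, ContinuousAt E w) (b : ℝ) :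
    shiftMeanSquare E σ b ≤ ENNReal.ofReal (Real.exp (σ ^ 2)) *
      ∫⁻ y : ℝ, ‖H (σ + y * I) * (exp (b * (σ + y * I)) - 1)‖ₑ ^ 2 := by
  have hcontb : ∀ᵐ u : ℝ, ContinuousAt E (u + b) :=
    (measurePreserving_add_right volume b).quasiMeasurePreserving.ae hcont
  have hmeas := measurable_integral_gaussianReal hE
  refine lintegral_le_of_ae_tendsto (l := 𝓝[>] (0 : ℝ≥0)) (f := fun v u =>
    ‖∫ w, E w ∂gaussianReal (u + b) v - ∫ w, E w ∂gaussianReal u v‖ₑ ^ 2 *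
      ENNReal.ofReal (Real.exp (-2 * σ * u))) (fun v => ?_) ?_ (Eventually.frequently ?_)
  · exact (((((hmeas v).comp (measurable_add_const b)).sub (hmeas v)).enorm.pow_const 2).mul
      (by fun_prop))
  · filter_upwards [hcont, hcontb] with u hu hub
    have hlim := ((tendsto_integral_gaussianReal hE hle hub).sub
      (tendsto_integral_gaussianReal hE hle hu)).mono_left (nhdsWithin_le_nhds (s := Ioi 0))
    exact ENNReal.Tendsto.mul_const ((ENNReal.continuous_pow 2).tendsto _ |>.comp hlim.enorm)
      (Or.inr ENNReal.ofReal_ne_top)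
  · filter_upwards [Ioc_mem_nhdsGT zero_lt_one] with v hv
    exact h.lintegral_enorm_sq_gaussian_sub_le hv.1.ne' hv.2 b

end IsLaplaceContinuation

/-! ### Weighted moments of the zeta function -/

section PartialIntegration

variable {f : ℝ → ℝ} {C κ p T : ℝ}

theorem continuousOn_add_one_rpow (r : ℝ) : ContinuousOn (fun t : ℝ => (t + 1) ^ r) (Ici 0) :=
  ContinuousOn.rpow_const (by fun_prop) fun t (_ : 0 ≤ t) => Or.inl (by positivity)

theorem intervalIntegral_add_one_rpow_mul (hf : Continuous f) (p : ℝ) (hT : 0 ≤ T) :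
    ∫ t in (0 : ℝ)..T, (t + 1) ^ (-p) * f t =
      (T + 1) ^ (-p) * (∫ t in (0 : ℝ)..T, f t) +
        ∫ t in (0 : ℝ)..T, p * (t + 1) ^ (-p - 1) * ∫ x in (0 : ℝ)..t, f x := by
  have hsub : uIcc 0 T ⊆ Ici 0 := by
    rw [uIcc_of_le hT]
    exact Icc_subset_Ici_self
  have hderiv : ∀ t ∈ uIcc 0 T,
      HasDerivAt (fun t : ℝ => (t + 1) ^ (-p)) (-p * (t + 1) ^ (-p - 1)) t := fun t ht => by
    have : 0 ≤ t := hsub ht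
    simpa using ((hasDerivAt_id t).add_const 1).rpow_const (p := -p)
      (Or.inl (by simp only [id]; positivity))
  rw [intervalIntegral.integral_mul_deriv_eq_deriv_mul hderiv
    (v := fun t => ∫ x in (0 : ℝ)..t, f x)
    (fun t _ => (hf.integral_hasStrictDerivAt 0 t).hasDerivAt)
    (continuousOn_const.mul ((continuousOn_add_one_rpow _).mono hsub)).intervalIntegrable
    (hf.intervalIntegrable _ _), intervalIntegral.integral_same, mul_zero, sub_zero,
    sub_eq_add_neg, ← intervalIntegral.integral_neg]
  simp only [neg_mul, neg_neg]

theorem intervalIntegral_add_one_rpow_mul_le (hf : Continuous f) (hp0 : 0 ≤ p) (hp : κ < p)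
    (hF : ∀ T, 0 ≤ T → ∫ t in (0 : ℝ)..T, f t ≤ C * (T + 1) ^ κ) (hT : 0 ≤ T) :
    ∫ t in (0 : ℝ)..T, (t + 1) ^ (-p) * f t ≤
      C + p * C * ∫ t in Ioi (0 : ℝ), (t + 1) ^ (κ - p - 1) := by
  have hC : 0 ≤ C := by simpa using hF 0 le_rfl
  have hmul : ∀ t, 0 ≤ t → ∀ r, (t + 1) ^ r * ∫ x in (0 : ℝ)..t, f x ≤ C * (t + 1) ^ (κ + r) := by
    intro t ht r
    rw [Real.rpow_add (by positivity), ← mul_assoc, mul_comm _ ((t + 1) ^ r)]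
    exact mul_le_mul_of_nonneg_left (hF t ht) (by positivity)
  have hsub : uIcc 0 T ⊆ Ici 0 := by
    rw [uIcc_of_le hT]
    exact Icc_subset_Ici_self
  have hcont : ∀ r : ℝ, ContinuousOn (fun t : ℝ => (t + 1) ^ r) (uIcc 0 T) := fun r =>
    (continuousOn_add_one_rpow r).mono hsub
  have hprim : Continuous fun t => ∫ x in (0 : ℝ)..t, f x :=
    intervalIntegral.continuous_primitive (fun a b => hf.intervalIntegrable a b) 0
  rw [intervalIntegral_add_one_rpow_mul hf p hT]
  refine add_le_add ((hmul T hT _).trans (mul_le_of_le_one_right hC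
    (Real.rpow_le_one_of_one_le_of_nonpos (by linarith) (by linarith)))) ?_
  calc ∫ t in (0 : ℝ)..T, p * (t + 1) ^ (-p - 1) * ∫ x in (0 : ℝ)..t, f x
      ≤ ∫ t in (0 : ℝ)..T, p * C * (t + 1) ^ (κ - p - 1) := by
        refine intervalIntegral.integral_mono_on hT
          ((continuousOn_const.mul (hcont _)).mul hprim.continuousOn).intervalIntegrable
          (continuousOn_const.mul (hcont _)).intervalIntegrable fun t ht => ?_
        rw [mul_assoc, mul_assoc, sub_sub, sub_eq_add_neg κ, neg_add']
        exact mul_le_mul_of_nonneg_left (hmul t ht.1 _) hp0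
    _ = p * C * ∫ t in (0 : ℝ)..T, (t + 1) ^ (κ - p - 1) := intervalIntegral.integral_const_mul _ _
    _ ≤ p * C * ∫ t in Ioi (0 : ℝ), (t + 1) ^ (κ - p - 1) := by
        rw [intervalIntegral.integral_of_le hT]
        refine mul_le_mul_of_nonneg_left (setIntegral_mono_set
          (integrableOn_add_rpow_Ioi_of_lt (by linarith) (by norm_num)) ?_
          Ioc_subset_Ioi_self.eventuallyLE) (by positivity)
        filter_upwards [ae_restrict_mem measurableSet_Ioi] with t (ht : 0 < t)
        positivity

theorem integrableOn_add_one_rpow_mul (hf : Continuous f) (hf0 : ∀ t, 0 ≤ f t) (hp0 : 0 ≤ p)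
    (hp : κ < p) (hF : ∀ T, 0 ≤ T → ∫ t in (0 : ℝ)..T, f t ≤ C * (T + 1) ^ κ) :
    IntegrableOn (fun t => (t + 1) ^ (-p) * f t) (Ioi 0) := by
  refine integrableOn_Ioi_of_intervalIntegral_norm_bounded (l := atTop) (b := fun T : ℝ => T)
    (C + p * C * ∫ t in Ioi (0 : ℝ), (t + 1) ^ (κ - p - 1)) 0 (fun T => ?_) tendsto_id ?_
  · exact (((continuousOn_add_one_rpow (-p)).mul hf.continuousOn).mono
      Icc_subset_Ici_self).integrableOn_Icc.mono_set Ioc_subset_Icc_self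
  · filter_upwards [eventually_ge_atTop 0] with T hT
    refine le_of_eq_of_le (intervalIntegral.integral_congr fun t ht => ?_)
      (intervalIntegral_add_one_rpow_mul_le hf hp0 hp hF hT)
    rw [uIcc_of_le hT] at ht
    have : 0 ≤ t := ht.1
    have := hf0 t
    exact Real.norm_of_nonneg (by positivity)

end PartialIntegration

theorem exists_le_mul_add_one_rpow_of_isBigO {F : ℝ → ℝ} {r : ℝ} (hF : MonotoneOn F (Ici 0))
    (hr : 0 ≤ r) (hO : F =O[atTop] fun T : ℝ => T ^ r) :
    ∃ C : ℝ, ∀ T, 0 ≤ T → F T ≤ C * (T + 1) ^ r := by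
  obtain ⟨C, hC⟩ := hO.bound
  obtain ⟨T₀, hT₀⟩ := eventually_atTop.1 hC
  refine ⟨max |C| |F (max T₀ 0)|, fun T hT => ?_⟩
  rcases le_total T (max T₀ 0) with h | h
  · calc F T ≤ F (max T₀ 0) := hF hT (hT.trans h) h
      _ ≤ max |C| |F (max T₀ 0)| := (le_abs_self _).trans (le_max_right _ _)
      _ ≤ _ := le_mul_of_one_le_right (by positivity) (Real.one_le_rpow (by linarith) hr)
  · calc F T ≤ C * ‖T ^ r‖ := (Real.le_norm_self _).trans (hT₀ T ((le_max_left _ _).trans h))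
      _ = C * T ^ r := by rw [Real.norm_of_nonneg (by positivity)]
      _ ≤ max |C| |F (max T₀ 0)| * (T + 1) ^ r := by
        gcongr
        · exact (le_abs_self C).trans (le_max_left _ _)
        · linarith

theorem continuous_riemannZeta_vertical {σ : ℝ} (hσ : σ ≠ 1) :
    Continuous fun t : ℝ => riemannZeta (σ + t * I) := by
  refine continuous_iff_continuousAt.2 fun t => ?_
  have hne : (σ : ℂ) + t * I ≠ 1 := fun h => hσ (by simpa using congrArg re h)
  exact (differentiableAt_riemannZeta hne).continuousAt.comp
    (f := fun t : ℝ => (σ : ℂ) + t * I) (by fun_prop)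

theorem norm_riemannZeta_vertical_neg (σ t : ℝ) :
    ‖riemannZeta (σ + (-t : ℝ) * I)‖ = ‖riemannZeta (σ + t * I)‖ := by
  have hconj : (σ : ℂ) + (-t : ℝ) * I = (starRingEnd ℂ) (σ + t * I) := by simp
  rw [hconj, riemannZeta_conj, RCLike.norm_conj]

theorem IsAdmissibleSigma.integrable_weighted_moment {k : ℕ} {σ : ℝ} (h : IsAdmissibleSigma k σ)
    {η : ℝ} (hη : 0 < η) :
    Integrable fun t : ℝ => (|t| + 1) ^ (-(1 + η)) * ‖riemannZeta (σ + t * I)‖ ^ (2 * k) := by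
  have hcont : Continuous fun t : ℝ => ‖riemannZeta (σ + t * I)‖ ^ (2 * k) :=
    (continuous_riemannZeta_vertical h.2.1.ne).norm.pow _
  have hmono : MonotoneOn (fun T : ℝ => ∫ t in (0 : ℝ)..T, ‖riemannZeta (σ + t * I)‖ ^ (2 * k))
      (Ici 0) := fun S hS T _ hST => intervalIntegral.integral_mono_interval le_rfl hS hST
    (Eventually.of_forall fun t => by positivity) (hcont.intervalIntegrable _ _)
  obtain ⟨C, hC⟩ := exists_le_mul_add_one_rpow_of_isBigO hmono (by positivity)
    (h.2.2 (η / 2) (half_pos hη))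
  have hpos := integrableOn_add_one_rpow_mul hcont (fun t => by positivity)
    (p := 1 + η) (by positivity) (by linarith) hC
  have hweight : Continuous fun t : ℝ => (|t| + 1) ^ (-(1 + η)) :=
    Continuous.rpow_const (by fun_prop) fun t => Or.inl (by positivity)
  refine (hweight.mul hcont).locallyIntegrable.integrable_of_isBigO_atTop_of_norm_isNegInvariant
    (Eventually.of_forall fun t => ?_) (EventuallyEq.isBigO ?_) ⟨Ioi 0, Ioi_mem_atTop 0, hpos⟩
  · simp only [Function.comp_apply, Pi.mul_apply, abs_neg, norm_mul, norm_pow, norm_norm,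
      norm_riemannZeta_vertical_neg]
  · filter_upwards [eventually_ge_atTop 0] with t ht
    rw [Pi.mul_apply, abs_of_nonneg ht]

/-! ### Mean square of the remainder under multiplicative shifts -/

theorem norm_cexp_sub_one_sq_le {z : ℂ} {c r : ℝ} (hc : 0 ≤ c) (hz : z.re ≤ c) (hr0 : 0 ≤ r)
    (hr2 : r ≤ 2) : ‖exp z - 1‖ ^ 2 ≤ (Real.exp c + 1) ^ 2 * ‖z‖ ^ r := by
  rcases le_total ‖z‖ 1 with h | h
  · calc ‖exp z - 1‖ ^ 2 ≤ ((1 + 1) * ‖z‖) ^ 2 := by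
          gcongr
          exact (norm_exp_sub_one_le h).trans_eq (by norm_num)
      _ = (1 + 1) ^ 2 * ‖z‖ ^ (2 : ℝ) := by rw [mul_pow, Real.rpow_two]
      _ ≤ (Real.exp c + 1) ^ 2 * ‖z‖ ^ r := by
        gcongr ?_ ^ 2 * ?_
        · exact add_le_add_left (Real.one_le_exp hc) 1
        · exact Real.rpow_le_rpow_of_exponent_ge' (norm_nonneg z) h hr0 hr2
  · calc ‖exp z - 1‖ ^ 2 ≤ (Real.exp c + 1) ^ 2 := by
          gcongr
          refine (norm_sub_le _ _).trans ?_
          rw [norm_one, norm_exp]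
          gcongr
      _ ≤ _ := le_mul_of_one_le_right (by positivity) (Real.one_le_rpow h hr0)

theorem lintegral_enorm_sq_mul_cexp_sub_one_le {H : ℂ → ℂ} {σ r b c : ℝ} (hr0 : 0 ≤ r)
    (hr2 : r ≤ 2) (hb : 0 ≤ b) (hc : 0 ≤ c) (hbc : b * σ ≤ c)
    (hH : Integrable fun y : ℝ => ‖H (σ + y * I)‖ ^ 2 * ‖(σ : ℂ) + y * I‖ ^ r) :
    ∫⁻ y : ℝ, ‖H (σ + y * I) * (exp (b * (σ + y * I)) - 1)‖ₑ ^ 2 ≤ ENNReal.ofReal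
      ((∫ y : ℝ, ‖H (σ + y * I)‖ ^ 2 * ‖(σ : ℂ) + y * I‖ ^ r) *
        ((Real.exp c + 1) ^ 2 * b ^ r)) := by
  rw [← integral_mul_const, ofReal_integral_eq_lintegral_ofReal (hH.mul_const _)
    (Eventually.of_forall fun y => by positivity)]
  refine lintegral_mono fun y => ?_
  rw [← ofReal_norm, ← ENNReal.ofReal_pow (norm_nonneg _), norm_mul, mul_pow, mul_assoc]
  refine ENNReal.ofReal_le_ofReal (mul_le_mul_of_nonneg_left ?_ (by positivity))
  calc ‖exp (b * (σ + y * I)) - 1‖ ^ 2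
      ≤ (Real.exp c + 1) ^ 2 * ‖(b : ℂ) * (σ + y * I)‖ ^ r :=
        norm_cexp_sub_one_sq_le hc (by simpa using hbc) hr0 hr2
    _ = (Real.exp c + 1) ^ 2 * (b ^ r * ‖(σ : ℂ) + y * I‖ ^ r) := by
        rw [norm_mul, norm_real, Real.norm_of_nonneg hb, Real.mul_rpow hb (norm_nonneg _)]
    _ = _ := by ring

theorem abs_add_one_le_three_mul_norm {σ : ℝ} (hσ : 1 / 2 ≤ σ) (y : ℝ) :
    |y| + 1 ≤ 3 * ‖(σ : ℂ) + y * I‖ := by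
  have him : |y| ≤ ‖(σ : ℂ) + y * I‖ := by simpa using abs_im_le_norm ((σ : ℂ) + y * I)
  have hre : σ ≤ ‖(σ : ℂ) + y * I‖ := by
    simpa using (le_abs_self _).trans (abs_re_le_norm ((σ : ℂ) + y * I))
  linarith

theorem continuous_zetaPowRegularPart_vertical (k : ℕ) {σ : ℝ} (hσ : 0 < σ) :
    Continuous fun y : ℝ => zetaPowRegularPart k (σ + y * I) :=
  (hasPoleExpansion_zetaPow k).differentiableOn.continuousOn.comp_continuous (by fun_prop)
    fun y => by simpa using hσ

theorem IsAdmissibleSigma.integrable_norm_sq_zetaPowRegularPart_mul_rpow {k : ℕ} {σ : ℝ}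
    (h : IsAdmissibleSigma k σ) {η : ℝ} (hη : 0 < η) :
    Integrable fun y : ℝ =>
      ‖zetaPowRegularPart k (σ + y * I)‖ ^ 2 * ‖(σ : ℂ) + y * I‖ ^ (1 - η) := by
  have hσ : 0 < σ := by linarith [h.1]
  obtain ⟨B, hB⟩ := exists_norm_sq_zetaPowRegularPart_mul_le k hσ h.2.1
  have hs : ∀ y : ℝ, 0 < ‖(σ : ℂ) + y * I‖ := fun y =>
    norm_pos_iff.2 fun h0 => hσ.ne' (by simpa using congrArg re h0)
  have hweight : Integrable fun y : ℝ => (|y| + 1) ^ (-(1 + η)) := by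
    refine (integrable_one_add_norm (μ := (volume : Measure ℝ)) (r := 1 + η) (by simpa)).congr
      (Eventually.of_forall fun y => ?_)
    simp only [Real.norm_eq_abs, add_comm]
  refine ((((h.integrable_weighted_moment hη).const_mul 2).add (hweight.mul_const B)).const_mul
    (3 ^ (1 + η))).mono' ?_ (Eventually.of_forall fun y => ?_)
  · exact (((continuous_zetaPowRegularPart_vertical k hσ).norm.pow 2).mul
      (Continuous.rpow_const (by fun_prop) fun y => Or.inl (hs y).ne')).aestronglyMeasurable
  rw [Real.norm_of_nonneg (by positivity)]
  have hsplit : ‖(σ : ℂ) + y * I‖ ^ (1 - η) =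
      ‖(σ : ℂ) + y * I‖ ^ 2 * ‖(σ : ℂ) + y * I‖ ^ (-(1 + η)) := by
    rw [← Real.rpow_two, ← Real.rpow_add (hs y)]
    ring_nf
  have hdecay : ‖(σ : ℂ) + y * I‖ ^ (-(1 + η)) ≤ 3 ^ (1 + η) * (|y| + 1) ^ (-(1 + η)) := by
    calc ‖(σ : ℂ) + y * I‖ ^ (-(1 + η)) ≤ (3⁻¹ * (|y| + 1)) ^ (-(1 + η)) :=
          Real.rpow_le_rpow_of_nonpos (by positivity)
            (by linarith [abs_add_one_le_three_mul_norm h.1 y]) (by linarith)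
      _ = _ := by
          rw [Real.mul_rpow (by norm_num) (by positivity), Real.inv_rpow (by norm_num),
            Real.rpow_neg (by norm_num), inv_inv]
  calc _ = ‖zetaPowRegularPart k (σ + y * I)‖ ^ 2 * ‖(σ : ℂ) + y * I‖ ^ 2 *
        ‖(σ : ℂ) + y * I‖ ^ (-(1 + η)) := by rw [hsplit, mul_assoc]
    _ ≤ (2 * ‖riemannZeta (σ + y * I)‖ ^ (2 * k) + B) *
        (3 ^ (1 + η) * (|y| + 1) ^ (-(1 + η))) :=
        mul_le_mul (hB y) hdecay (by positivity) ((by positivity : (0 : ℝ) ≤ _).trans (hB y))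
    _ = _ := by
        simp only [Pi.add_apply]
        ring

theorem integrable_divisorRemainder_mul_cexp (k : ℕ) {s : ℂ} (hs : k + 2 < s.re) :
    Integrable fun w : ℝ => divisorRemainder k w * exp (-s * w) := by
  obtain ⟨D, hD⟩ := exists_norm_divisorRemainder_le k
  have hpos := Iff.mpr integrableOn_Ici_iff_integrableOn_Ioi
    (integrableOn_Ioi_mul_cexp_of_norm_le (measurable_divisorRemainder k) (fun w _ => hD w) hs)
  refine (integrableOn_iff_integrable_of_support_subset fun w hw => ?_).1 hpos
  by_contra hneg
  have hw0 : w < 0 := not_le.1 fun h0 => hneg (mem_Ici.2 h0)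
  exact hw (by simp only [divisorRemainder, if_pos hw0, zero_mul])

theorem isLaplaceContinuation_divisorRemainder (k : ℕ) {σ : ℝ} (hσ : 0 < σ) (hσk : σ ≤ k + 3) :
    IsLaplaceContinuation (divisorRemainder k) (zetaPowRegularPart k) σ (k + 3) where
  le := hσk
  integrable := by
    exact_mod_cast integrable_divisorRemainder_mul_cexp k (s := ((k + 3 : ℝ) : ℂ))
      (by rw [ofReal_re]; linarith)
  integral_eq y := integral_divisorRemainder_mul_cexp k (by simp; norm_num)
  differentiableOn := (hasPoleExpansion_zetaPow k).differentiableOn.mono fun _ hs =>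
    hσ.trans_le (mem_reProdIm.1 hs).1.1
  exists_norm_le := ⟨k, exists_norm_zetaPowRegularPart_le_exp k hσ (k + 3)⟩

theorem IsAdmissibleSigma.exists_shiftMeanSquare_divisorRemainder_le {k : ℕ} {σ : ℝ}
    (h : IsAdmissibleSigma k σ) {η : ℝ} (hη : 0 < η) (hη1 : η ≤ 1) :
    ∃ C : ℝ, 0 ≤ C ∧ ∀ b : ℝ, 0 ≤ b → b ≤ 2 →
      shiftMeanSquare (divisorRemainder k) σ b ≤ ENNReal.ofReal (C * b ^ (1 - η)) := by
  obtain ⟨D, hD⟩ := exists_norm_divisorRemainder_le k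
  have hD0 : 0 ≤ D := by simpa using (norm_nonneg _).trans (hD 0)
  have hle : ∀ w, ‖divisorRemainder k w‖ ≤ D * Real.exp ((k + 2) * |w|) := fun w =>
    (hD w).trans (by gcongr; exact le_abs_self w)
  have hcontinuation := isLaplaceContinuation_divisorRemainder k (σ := σ) (by linarith [h.1])
    (by linarith [h.2.1, (Nat.cast_nonneg k : (0 : ℝ) ≤ k)])
  refine ⟨Real.exp (σ ^ 2) * ((∫ y : ℝ,
    ‖zetaPowRegularPart k (σ + y * I)‖ ^ 2 * ‖(σ : ℂ) + y * I‖ ^ (1 - η)) *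
      (Real.exp 2 + 1) ^ 2), ?_, fun b hb0 hb2 => ?_⟩
  · have : 0 ≤ ∫ y : ℝ,
        ‖zetaPowRegularPart k (σ + y * I)‖ ^ 2 * ‖(σ : ℂ) + y * I‖ ^ (1 - η) :=
      integral_nonneg fun y => by positivity
    positivity
  · refine (hcontinuation.shiftMeanSquare_le (measurable_divisorRemainder k) hle
      (ae_continuousAt_divisorRemainder k) b).trans ?_
    rw [mul_assoc, mul_assoc, ENNReal.ofReal_mul (by positivity)]
    gcongr
    exact lintegral_enorm_sq_mul_cexp_sub_one_le (by linarith) (by linarith) hb0 zero_le_two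
      (by nlinarith [h.1, h.2.1]) (h.integrable_norm_sq_zetaPowRegularPart_mul_rpow hη)

/-! ### From multiplicative to additive shifts -/

theorem setLIntegral_Icc_comp_add_right (g : ℝ → ENNReal) (p q h : ℝ) :
    ∫⁻ x in Icc p q, g (x + h) = ∫⁻ x in Icc (p + h) (q + h), g x := by
  simpa using (measurePreserving_add_right volume h).setLIntegral_comp_preimage_emb
    (Homeomorph.addRight h).measurableEmbedding g (Icc (p + h) (q + h))

theorem setLIntegral_Icc_le_mul_comp_mul_left (g : ℝ → ENNReal) {x a b : ℝ} (hx : 0 < x)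
    (hab : a ≤ x * b) :
    ∫⁻ v in Icc 0 a, g v ≤ ENNReal.ofReal x * ∫⁻ δ in Icc 0 b, g (x * δ) := by
  have hsub : Icc 0 a ⊆ (fun δ => x * δ) '' Icc 0 b := fun v hv =>
    ⟨v / x, ⟨div_nonneg hv.1 hx.le, (div_le_iff₀' hx).2 (hv.2.trans hab)⟩,
      mul_div_cancel₀ _ hx.ne'⟩
  refine (lintegral_mono_set hsub).trans_eq ?_
  rw [lintegral_image_eq_lintegral_abs_deriv_mul measurableSet_Icc
    (f' := fun _ => x) (fun δ _ => (hasDerivAt_const_mul x).hasDerivWithinAt)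
    (mul_right_injective₀ hx.ne').injOn, abs_of_pos hx,
    lintegral_const_mul' _ _ ENNReal.ofReal_ne_top]

theorem setLIntegral_Ioi_zero_eq_lintegral_exp (g : ℝ → ENNReal) :
    ∫⁻ x in Ioi (0 : ℝ), g x = ∫⁻ u : ℝ, ENNReal.ofReal (Real.exp u) * g (Real.exp u) := by
  rw [← Real.range_exp, ← image_univ, lintegral_image_eq_lintegral_abs_deriv_mul MeasurableSet.univ
    (fun x _ => (Real.hasDerivAt_exp x).hasDerivWithinAt) Real.exp_injective.injOn,
    Measure.restrict_univ]
  simp only [Real.abs_exp]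

section Averaging

variable {F : Type*} [NormedAddCommGroup F]

theorem enorm_sub_sq_le (x y z : F) : ‖y - x‖ₑ ^ 2 ≤ 2 * ‖z - x‖ₑ ^ 2 + 2 * ‖z - y‖ₑ ^ 2 := by
  have htriangle : ‖y - x‖ₑ ≤ ‖z - x‖ₑ + ‖z - y‖ₑ := by
    simpa only [edist_eq_enorm_sub, add_comm] using edist_triangle_left y x z
  calc ‖y - x‖ₑ ^ 2 ≤ (‖z - x‖ₑ + ‖z - y‖ₑ) ^ 2 := by gcongr
    _ ≤ 2 * ‖z - x‖ₑ ^ 2 + 2 * ‖z - y‖ₑ ^ 2 := by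
        simpa [show (2 : ℝ) - 1 = 1 by norm_num, mul_add] using
          ENNReal.rpow_add_le_mul_rpow_add_rpow ‖z - x‖ₑ ‖z - y‖ₑ one_le_two

theorem ofReal_mul_le_four_mul_setLIntegral {B : ℝ → ENNReal} (hB : Measurable B) {h : ℝ}
    (hh : 0 ≤ h) {c : ENNReal}
    (hc : ∀ v ∈ Icc (2 * h) (3 * h), c ≤ 2 * B v + 2 * B (v + -h)) :
    ENNReal.ofReal h * c ≤ 4 * ∫⁻ v in Icc 0 (3 * h), B v := by
  calc ENNReal.ofReal h * c = ∫⁻ _ in Icc (2 * h) (3 * h), c := by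
        rw [setLIntegral_const, Real.volume_Icc, mul_comm]
        ring_nf
    _ ≤ ∫⁻ v in Icc (2 * h) (3 * h), (2 * B v + 2 * B (v + -h)) :=
        setLIntegral_mono' measurableSet_Icc hc
    _ = 2 * (∫⁻ v in Icc (2 * h) (3 * h), B v) +
        2 * ∫⁻ v in Icc (2 * h + -h) (3 * h + -h), B v := by
        rw [lintegral_add_left (hB.const_mul 2), lintegral_const_mul' _ _ (by simp),
          lintegral_const_mul' _ _ (by simp), setLIntegral_Icc_comp_add_right B]
    _ ≤ 2 * (∫⁻ v in Icc 0 (3 * h), B v) + 2 * ∫⁻ v in Icc 0 (3 * h), B v := by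
        gcongr <;> linarith
    _ = 4 * ∫⁻ v in Icc 0 (3 * h), B v := by
        rw [← add_mul]
        norm_num

variable [MeasurableSpace F] [BorelSpace F] [SecondCountableTopology F] {f : ℝ → F}

theorem setLIntegral_enorm_shift_sub_sq_le (hf : Measurable f) {X h : ℝ} (hh : 0 ≤ h)
    (hhX : h ≤ X) (v : ℝ) :
    ∫⁻ x in Icc X (2 * X), ‖f (x + h) - f x‖ₑ ^ 2 ≤
      2 * (∫⁻ x in Icc X (3 * X), ‖f (x + v) - f x‖ₑ ^ 2) +
      2 * ∫⁻ x in Icc X (3 * X), ‖f (x + (v + -h)) - f x‖ₑ ^ 2 := by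
  calc ∫⁻ x in Icc X (2 * X), ‖f (x + h) - f x‖ₑ ^ 2
      ≤ ∫⁻ x in Icc X (2 * X), (2 * ‖f (x + v) - f x‖ₑ ^ 2 +
          2 * ‖f (x + h + (v + -h)) - f (x + h)‖ₑ ^ 2) := by
        refine lintegral_mono fun x => ?_
        rw [show x + h + (v + -h) = x + v by ring]
        exact enorm_sub_sq_le _ _ _
    _ = 2 * (∫⁻ x in Icc X (2 * X), ‖f (x + v) - f x‖ₑ ^ 2) +
        2 * ∫⁻ x in Icc (X + h) (2 * X + h), ‖f (x + (v + -h)) - f x‖ₑ ^ 2 := by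
        rw [lintegral_add_left (by fun_prop), lintegral_const_mul' _ _ (by simp),
          lintegral_const_mul' _ _ (by simp),
          setLIntegral_Icc_comp_add_right fun y => ‖f (y + (v + -h)) - f y‖ₑ ^ 2]
    _ ≤ _ := by
        gcongr <;> linarith

theorem ofReal_mul_setLIntegral_enorm_shift_sub_sq_le (hf : Measurable f) {X h : ℝ}
    (hh : 0 ≤ h) (hhX : h ≤ X) :
    ENNReal.ofReal h * ∫⁻ x in Icc X (2 * X), ‖f (x + h) - f x‖ₑ ^ 2 ≤
      4 * ∫⁻ v in Icc 0 (3 * h), ∫⁻ x in Icc X (3 * X), ‖f (x + v) - f x‖ₑ ^ 2 :=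
  ofReal_mul_le_four_mul_setLIntegral
    (B := fun v => ∫⁻ x in Icc X (3 * X), ‖f (x + v) - f x‖ₑ ^ 2)
    (Measurable.lintegral_prod_right' (f := fun p : ℝ × ℝ => ‖f (p.2 + p.1) - f p.2‖ₑ ^ 2)
      (by fun_prop)) hh
    fun v _ => setLIntegral_enorm_shift_sub_sq_le hf hh hhX v

theorem lintegral_additive_shift_le_lintegral_multiplicative_shift (hf : Measurable f)
    {X Y a : ℝ} (hX : 0 < X) (ha : 0 ≤ a) :
    ∫⁻ v in Icc 0 a, ∫⁻ x in Icc X Y, ‖f (x + v) - f x‖ₑ ^ 2 ≤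
      ENNReal.ofReal Y *
        ∫⁻ δ in Icc 0 (a / X), ∫⁻ x in Icc X Y, ‖f (x + x * δ) - f x‖ₑ ^ 2 := by
  rw [lintegral_lintegral_swap (by fun_prop),
    lintegral_lintegral_swap (f := fun δ x => ‖f (x + x * δ) - f x‖ₑ ^ 2) (by fun_prop),
    ← lintegral_const_mul' _ _ ENNReal.ofReal_ne_top]
  refine setLIntegral_mono' measurableSet_Icc fun x hx => ?_
  have hax : a ≤ x * (a / X) := by
    rw [← mul_div_assoc, le_div_iff₀' hX]
    gcongr
    exact hx.1
  refine (setLIntegral_Icc_le_mul_comp_mul_left (fun v => ‖f (x + v) - f x‖ₑ ^ 2)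
    (hX.trans_le hx.1) hax).trans ?_
  gcongr
  exact hx.2

end Averaging

theorem shiftMeanSquare_eq_setLIntegral_log (E : ℝ → ℂ) (σ b : ℝ) :
    shiftMeanSquare E σ b = ∫⁻ x in Ioi (0 : ℝ),
      ‖E (Real.log x + b) - E (Real.log x)‖ₑ ^ 2 * ENNReal.ofReal (x ^ (-(2 * σ + 1))) := by
  rw [shiftMeanSquare, setLIntegral_Ioi_zero_eq_lintegral_exp]
  refine lintegral_congr fun u => ?_
  rw [Real.log_exp, mul_left_comm, ← ENNReal.ofReal_mul (Real.exp_pos u).le, ← Real.exp_mul,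
    ← Real.exp_add]
  ring_nf

theorem setLIntegral_enorm_multiplicative_shift_sub_sq_le (E : ℝ → ℂ) {σ X Y δ : ℝ}
    (hσ : 0 ≤ 2 * σ + 1) (hX : 0 < X) (hδ : 0 ≤ δ) :
    ∫⁻ x in Icc X Y, ‖E (Real.log (x + x * δ)) - E (Real.log x)‖ₑ ^ 2 ≤
      ENNReal.ofReal (Y ^ (2 * σ + 1)) * shiftMeanSquare E σ (Real.log (1 + δ)) := by
  rw [shiftMeanSquare_eq_setLIntegral_log, ← lintegral_const_mul' _ _ ENNReal.ofReal_ne_top]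
  refine (setLIntegral_mono' measurableSet_Icc fun x hx => ?_).trans
    (lintegral_mono_set fun x hx => hX.trans_le hx.1)
  have hx0 : 0 < x := hX.trans_le hx.1
  have hlog : Real.log (x + x * δ) = Real.log x + Real.log (1 + δ) := by
    rw [← Real.log_mul hx0.ne' (by linarith)]
    ring_nf
  have hweight : 1 ≤ Y ^ (2 * σ + 1) * x ^ (-(2 * σ + 1)) := by
    rw [Real.rpow_neg hx0.le, ← div_eq_mul_inv, one_le_div (by positivity)]
    exact Real.rpow_le_rpow hx0.le hx.2 hσ
  have hY : 0 ≤ Y := hx0.le.trans hx.2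
  rw [hlog, mul_left_comm, ← ENNReal.ofReal_mul (by positivity)]
  exact le_mul_of_one_le_right' (ENNReal.one_le_ofReal.2 hweight)

theorem log_one_add_le_two {δ : ℝ} (hδ : 0 ≤ δ) (hδ3 : δ ≤ 3) : Real.log (1 + δ) ≤ 2 := by
  rw [Real.log_le_iff_le_exp (by linarith)]
  linarith [Real.quadratic_le_exp_of_nonneg zero_le_two]

theorem setLIntegral_enorm_additive_shift_sub_sq_le {E : ℝ → ℂ} (hE : Measurable E)
    {σ C κ : ℝ} (hσ : 0 ≤ 2 * σ + 1) (hκ : 0 ≤ κ) (hC : 0 ≤ C)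
    (hshift : ∀ b : ℝ, 0 ≤ b → b ≤ 2 → shiftMeanSquare E σ b ≤ ENNReal.ofReal (C * b ^ κ))
    {X h : ℝ} (hh : 0 < h) (hhX : h ≤ X) :
    ∫⁻ x in Icc X (2 * X), ‖E (Real.log (x + h)) - E (Real.log x)‖ₑ ^ 2 ≤
      ENNReal.ofReal (36 * ((3 * X) ^ (2 * σ + 1) * (C * (3 * h / X) ^ κ))) := by
  have hX : 0 < X := hh.trans_le hhX
  have hf : Measurable fun x => E (Real.log x) := hE.comp Real.measurable_log
  set R := (3 * X) ^ (2 * σ + 1) * (C * (3 * h / X) ^ κ) with hR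
  have hR0 : 0 ≤ R := by positivity
  have hmul : ∀ δ ∈ Icc 0 (3 * h / X), ∫⁻ x in Icc X (3 * X),
      ‖E (Real.log (x + x * δ)) - E (Real.log x)‖ₑ ^ 2 ≤ ENNReal.ofReal R := by
    intro δ hδ
    have hδ3 : δ ≤ 3 := hδ.2.trans ((div_le_iff₀ hX).2 (by linarith))
    have hb0 : 0 ≤ Real.log (1 + δ) := Real.log_nonneg (by linarith [hδ.1])
    refine (setLIntegral_enorm_multiplicative_shift_sub_sq_le E hσ hX hδ.1).trans ?_
    rw [hR, ENNReal.ofReal_mul (by positivity)]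
    gcongr
    refine (hshift _ hb0 (log_one_add_le_two hδ.1 hδ3)).trans ?_
    gcongr
    linarith [Real.log_le_sub_one_of_pos (x := 1 + δ) (by linarith [hδ.1]), hδ.2]
  refine (ENNReal.mul_le_mul_iff_right (a := ENNReal.ofReal h) (by simpa using hh)
    ENNReal.ofReal_ne_top).1 ?_
  calc _ ≤ 4 * ∫⁻ v in Icc 0 (3 * h), ∫⁻ x in Icc X (3 * X),
        ‖E (Real.log (x + v)) - E (Real.log x)‖ₑ ^ 2 :=
        ofReal_mul_setLIntegral_enorm_shift_sub_sq_le hf hh.le hhX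
    _ ≤ 4 * (ENNReal.ofReal (3 * X) * ∫⁻ _ in Icc 0 (3 * h / X), ENNReal.ofReal R) := by
        gcongr
        refine (lintegral_additive_shift_le_lintegral_multiplicative_shift hf hX
          (by positivity)).trans ?_
        exact mul_le_mul_right (setLIntegral_mono' measurableSet_Icc hmul) _
    _ = ENNReal.ofReal h * ENNReal.ofReal (36 * R) := by
        rw [setLIntegral_const, Real.volume_Icc, sub_zero, ← ENNReal.ofReal_mul hR0,
          ← ENNReal.ofReal_mul (by positivity), ← ENNReal.ofReal_ofNat 4,
          ← ENNReal.ofReal_mul (by norm_num), ← ENNReal.ofReal_mul hh.le]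
        congr 1
        field_simp
        ring

/-! ### Short-interval mean squares -/

theorem divisorError_eq_re_divisorRemainder_log (k : ℕ) {x : ℝ} (hx : 1 ≤ x) :
    divisorError k x = (divisorRemainder k (Real.log x)).re := by
  rw [← divisorError_exp_eq_re_divisorRemainder k (Real.log_nonneg hx),
    Real.exp_log (by linarith)]

theorem shortMeanSquare_eq_setIntegral (k : ℕ) {X h : ℝ} (hX : 1 ≤ X) (hh : 0 ≤ h) :
    shortMeanSquare k X h = ∫ x in Icc X (2 * X),
      (divisorRemainder k (Real.log (x + h)) - divisorRemainder k (Real.log x)).re ^ 2 := by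
  rw [shortMeanSquare, intervalIntegral.integral_of_le (by linarith),
    ← integral_Icc_eq_integral_Ioc]
  refine setIntegral_congr_fun measurableSet_Icc fun x hx => ?_
  have hx1 : 1 ≤ x := hX.trans hx.1
  simp only [divisorError_eq_re_divisorRemainder_log k hx1,
    divisorError_eq_re_divisorRemainder_log k (show 1 ≤ x + h by linarith), sub_re]

theorem shortMeanSquare_le_of_setLIntegral_le (k : ℕ) {X h M : ℝ} (hX : 1 ≤ X) (hh : 0 ≤ h)
    (hM : 0 ≤ M)
    (hle : ∫⁻ x in Icc X (2 * X), ‖divisorRemainder k (Real.log (x + h)) -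
      divisorRemainder k (Real.log x)‖ₑ ^ 2 ≤ ENNReal.ofReal M) :
    shortMeanSquare k X h ≤ M := by
  have hmeas : Measurable fun x =>
      (divisorRemainder k (Real.log (x + h)) - divisorRemainder k (Real.log x)).re ^ 2 := by
    have := measurable_divisorRemainder k
    fun_prop
  rw [shortMeanSquare_eq_setIntegral k hX hh, integral_eq_lintegral_of_nonneg_ae
    (Eventually.of_forall fun x => sq_nonneg _) hmeas.aestronglyMeasurable]
  refine ENNReal.toReal_le_of_le_ofReal hM ((lintegral_mono fun x => ?_).trans hle)
  rw [← ofReal_norm, ← ENNReal.ofReal_pow (norm_nonneg _), ← sq_abs]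
  gcongr
  exact abs_re_le_norm _

theorem rpow_mul_div_rpow_le_rpow_mul {X h a η : ℝ} (hX : 0 < X) (hh : 1 ≤ h) (hη : 0 ≤ η) :
    X ^ (a + 1) * (h / X) ^ (1 - η) ≤ X ^ (a + η) * h := by
  have hsplit : X ^ (a + 1) = X ^ (a + η) * X ^ (1 - η) := by
    rw [← Real.rpow_add hX]
    ring_nf
  have hpos : 0 < X ^ (1 - η) := by positivity
  rw [Real.div_rpow (by linarith) hX.le, hsplit, mul_assoc, mul_div_cancel₀ _ hpos.ne']
  gcongr
  exact Real.rpow_le_self_of_one_le hh (by linarith)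

theorem IsAdmissibleSigma.exists_shortMeanSquare_le {k : ℕ} {σ : ℝ}
    (hadm : IsAdmissibleSigma k σ) {η : ℝ} (hη : 0 < η) :
    ∃ C : ℝ, 0 ≤ C ∧ ∀ X h : ℝ, 1 ≤ h → h ≤ X →
      shortMeanSquare k X h ≤ C * (X ^ (2 * σ + η) * h) := by
  have hν0 : 0 < min η 1 := lt_min hη one_pos
  have hν1 : min η 1 ≤ 1 := min_le_right _ _
  have hσ : 0 ≤ 2 * σ + 1 := by linarith [hadm.1]
  obtain ⟨C, hC0, hC⟩ := hadm.exists_shiftMeanSquare_divisorRemainder_le hν0 hν1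
  set ν := min η 1
  refine ⟨36 * (3 ^ (2 * σ + 1) * (C * 3 ^ (1 - ν))), by positivity, fun X h h1 hhX => ?_⟩
  have hX : 1 ≤ X := h1.trans hhX
  have hX0 : 0 < X := by linarith
  have hh0 : 0 < h := by linarith
  calc shortMeanSquare k X h
      ≤ 36 * ((3 * X) ^ (2 * σ + 1) * (C * (3 * h / X) ^ (1 - ν))) :=
        shortMeanSquare_le_of_setLIntegral_le k hX hh0.le (by positivity)
          (setLIntegral_enorm_additive_shift_sub_sq_le (measurable_divisorRemainder k) hσ
            (by linarith) hC0 hC hh0 hhX)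
    _ = 36 * (3 ^ (2 * σ + 1) * (C * 3 ^ (1 - ν))) *
          (X ^ (2 * σ + 1) * (h / X) ^ (1 - ν)) := by
        rw [Real.mul_rpow (by norm_num) hX0.le, mul_div_assoc,
          Real.mul_rpow (by norm_num) (by positivity)]
        ring
    _ ≤ 36 * (3 ^ (2 * σ + 1) * (C * 3 ^ (1 - ν))) * (X ^ (2 * σ + ν) * h) := by
        exact mul_le_mul_of_nonneg_left (rpow_mul_div_rpow_le_rpow_mul hX0 h1 hν0.le)
          (by positivity)
    _ ≤ 36 * (3 ^ (2 * σ + 1) * (C * 3 ^ (1 - ν))) * (X ^ (2 * σ + η) * h) := by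
        gcongr
        exact min_le_left _ _

theorem le_of_le_rpow_one_sub {X ε h : ℝ} (hX : 1 ≤ X) (hε : 0 ≤ ε) (hh : h ≤ X ^ (1 - ε)) :
    h ≤ X :=
  hh.trans (Real.rpow_le_self_of_one_le hX (by linarith))

theorem theorem1_general (k : ℕ) (σ : ℝ) (hσ : IsAdmissibleSigma k σ) :
    (σ = 1 / 2 →
      ∀ ε : ℝ, 0 < ε → ∃ C : ℝ, ∀ X h : ℝ, 1 ≤ X → X ^ ε ≤ h → h ≤ X ^ (1 - ε) →
        shortMeanSquare k X h ≤ C * (X ^ (1 + ε) * h ^ (4 / 3 : ℝ))) ∧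
    ∀ θ : ℝ, 2 * σ - 1 < θ →
      ∃ ε₁ : ℝ, 0 < ε₁ ∧ ∃ C : ℝ, ∀ ε : ℝ, 0 < ε →
        ∀ X h : ℝ, 1 ≤ X → X ^ θ ≤ h → h ≤ X ^ (1 - ε) →
          shortMeanSquare k X h ≤ C * (X ^ (1 - ε₁) * h ^ 2) := by
  refine ⟨fun hhalf ε hε => ?_, fun θ hθ => ?_⟩
  · obtain ⟨C, hC0, hC⟩ := hσ.exists_shortMeanSquare_le hε
    refine ⟨C, fun X h hX hXh hhX => ?_⟩
    have hh : 1 ≤ h := (Real.one_le_rpow hX hε.le).trans hXh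
    calc shortMeanSquare k X h ≤ C * (X ^ (2 * σ + ε) * h) :=
          hC X h hh (le_of_le_rpow_one_sub hX hε.le hhX)
      _ ≤ C * (X ^ (1 + ε) * h ^ (4 / 3 : ℝ)) := by
          rw [hhalf, mul_one_div_cancel two_ne_zero]
          gcongr
          exact Real.self_le_rpow_of_one_le hh (by norm_num)
  · obtain ⟨ε₁, hε₁, hθε⟩ : ∃ ε₁ > 0, 2 * σ + ε₁ = 1 - ε₁ + θ :=
      ⟨(θ - (2 * σ - 1)) / 2, by linarith, by ring⟩
    obtain ⟨C, hC0, hC⟩ := hσ.exists_shortMeanSquare_le hε₁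
    refine ⟨ε₁, hε₁, C, fun ε hε X h hX hXh hhX => ?_⟩
    have hh : 1 ≤ h := (Real.one_le_rpow hX (by linarith [hσ.1])).trans hXh
    calc shortMeanSquare k X h ≤ C * (X ^ (2 * σ + ε₁) * h) :=
          hC X h hh (le_of_le_rpow_one_sub hX hε.le hhX)
      _ = C * (X ^ (1 - ε₁) * X ^ θ * h) := by
          rw [hθε, Real.rpow_add (by linarith)]
      _ ≤ C * (X ^ (1 - ε₁) * h ^ 2) := by
          rw [sq, ← mul_assoc _ h]
          gcongr

theorem theorem1 (k : ℕ) (hk : 3 ≤ k) (σ : ℝ) (hσ : IsAdmissibleSigma k σ) :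
    (σ = 1 / 2 →
      ∀ ε : ℝ, 0 < ε → ∃ C : ℝ, ∀ X h : ℝ, 1 ≤ X → X ^ ε ≤ h → h ≤ X ^ (1 - ε) →
        shortMeanSquare k X h ≤ C * (X ^ (1 + ε) * h ^ (4 / 3 : ℝ))) ∧
    (1 / 2 < σ →
      ∀ θ : ℝ, 2 * σ - 1 < θ → θ < 1 →
        ∃ ε₁ : ℝ, 0 < ε₁ ∧ ∃ C : ℝ, ∀ ε : ℝ, 0 < ε →
          ∀ X h : ℝ, 1 ≤ X → X ^ θ ≤ h → h ≤ X ^ (1 - ε) →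
            shortMeanSquare k X h ≤ C * (X ^ (1 - ε₁) * h ^ 2)) :=
  ⟨(theorem1_general k σ hσ).1, fun _ θ hθ _ => (theorem1_general k σ hσ).2 θ hθ⟩
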